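/- For $f\in L^2(\mathbb R^n)$ let $\widehat f(\xi)=(2\pi)^{-n/2}\int e^{-ix\cdot\xi}f(x)\,dx$ be the ($L^2$) Fourier transform and, when $\operatorname{supp}\widehat f\subset B^n(0,1)$, let $$e^{it\Delta}f(x)=(2\pi)^{-n/2}\int e^{i(x\cdot\xi+t|\xi|^2)}\widehat f(\xi)\,d\xi .$$ For an integer $n\ge 1$ and real $p\ge 1$, let $\bar\gamma_{n,p}$ be the infimum of the real numbers $\gamma$ with the following property: for every $\varepsilon>0$ there is a constant $C_\varepsilon>0$ such that for all $R>1$ and all $f\in L^2(\mathbb R^n)$ with $\operatorname{supp}\widehat f\subset B^n(0,1)$, $$\Big\|\sup_{0<t\le R}|e^{it\Delta}f|\Big\|_{L^p(B^n(0,R))}\le C_\varepsilon R^{\varepsilon}R^{\gamma}\|f\|_{L^2}.$$ Put $p_0(n)=2+\frac{4}{(n-1)(n+2)}$ for $n\ge 2$ and $p_1(n)=\max_{m\in\mathbb Z,\,1\le m\le n}\Big(2+\frac{4}{n-1+m+n/m}\Big)$ for $n\ge1$. Let $n\ge 1$ and $p\ge 1$. (i) If $n\ge2$ and $\bar\gamma_{n,p}=n\big(\frac1p-\frac{n}{2(n+1)}\big)$,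 then $p\le p_0(n)$. (ii) If $\bar\gamma_{n,p}=0$, then $p\ge p_1(n)$. (iii) If $n\ge3$, then $p_0(n)<p_1(n)$, and for $p_0(n)<p<p_1(n)$ the conjectured formula $$\bar\gamma_{n,p}=\max\Big\{n\Big(\frac1p-\frac{n}{2(n+1)}\Big),0\Big\}$$ fails. -/

import Mathlib

open MeasureTheory
open scoped FourierTransform ENNReal

namespace SchrodingerMaximal

/-- The unitary Fourier transform `f̂(ξ) = (2π)^(-n/2) ∫ e^(-i x·ξ) f(x) dx` of `f ∈ L²(ℝⁿ)`.
It is obtained from Mathlib's `L²` Fourier transform `𝓕`, whose kernel is `e^(-2πi x·ξ)`, by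
`f̂(ξ) = (2π)^(-n/2) (𝓕 f)(ξ/(2π))`. -/
noncomputable def hat {n : ℕ} (f : Lp ℂ 2 (volume : Measure (EuclideanSpace ℝ (Fin n))))
    (ξ : EuclideanSpace ℝ (Fin n)) : ℂ :=
  (((2 * Real.pi) ^ (-(n : ℝ) / 2) : ℝ) : ℂ) *
    (𝓕 f : Lp ℂ 2 (volume : Measure (EuclideanSpace ℝ (Fin n)))) ((2 * Real.pi)⁻¹ • ξ)

/-- `supp f̂ ⊂ Bⁿ(0,1)`: the Fourier transform vanishes almost everywhere off the unit ball. -/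
def FourierSupportedInUnitBall {n : ℕ}
    (f : Lp ℂ 2 (volume : Measure (EuclideanSpace ℝ (Fin n)))) : Prop :=
  ∀ᵐ ξ : EuclideanSpace ℝ (Fin n), ξ ∉ Metric.ball (0 : EuclideanSpace ℝ (Fin n)) 1 → hat f ξ = 0

/-- `e^{itΔ}f(x) = (2π)^(-n/2) ∫ e^{i(x·ξ + t|ξ|²)} f̂(ξ) dξ`. It is used only for `f` whose
Fourier transform is supported in the unit ball, where the integral converges absolutely. -/
noncomputable def schrodinger {n : ℕ}
    (f : Lp ℂ 2 (volume : Measure (EuclideanSpace ℝ (Fin n))))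
    (t : ℝ) (x : EuclideanSpace ℝ (Fin n)) : ℂ :=
  (((2 * Real.pi) ^ (-(n : ℝ) / 2) : ℝ) : ℂ) *
    ∫ ξ : EuclideanSpace ℝ (Fin n),
      Complex.exp (Complex.I * ((inner ℝ x ξ + t * ‖ξ‖ ^ 2 : ℝ) : ℂ)) * hat f ξ

/-- `sup_{0 < t ≤ R} |e^{itΔ}f(x)|`, as an extended nonnegative number. -/
noncomputable def maximalFunction {n : ℕ}
    (f : Lp ℂ 2 (volume : Measure (EuclideanSpace ℝ (Fin n))))
    (R : ℝ) (x : EuclideanSpace ℝ (Fin n)) : ℝ≥0∞ :=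
  ⨆ t ∈ Set.Ioc (0 : ℝ) R, ‖schrodinger f t x‖ₑ

/-- The Schrödinger maximal estimate with exponent `γ`: for every `ε > 0` there is a constant
`C > 0` such that for all `R > 1` and all `f ∈ L²(ℝⁿ)` with `supp f̂ ⊂ Bⁿ(0,1)`,
`‖sup_{0<t≤R} |e^{itΔ}f|‖_{L^p(Bⁿ(0,R))} ≤ C R^ε R^γ ‖f‖_{L²}`. -/
def MaximalEstimate (n : ℕ) (p γ : ℝ) : Prop :=
  ∀ ε : ℝ, 0 < ε → ∃ C : ℝ, 0 < C ∧ ∀ R : ℝ, 1 < R →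
    ∀ f : Lp ℂ 2 (volume : Measure (EuclideanSpace ℝ (Fin n))), FourierSupportedInUnitBall f →
      eLpNorm (maximalFunction f R) (ENNReal.ofReal p)
          (volume.restrict (Metric.ball (0 : EuclideanSpace ℝ (Fin n)) R))
        ≤ ENNReal.ofReal (C * R ^ ε * (R ^ γ * ‖f‖))

/-- `γ̄_{n,p}`: the infimum of the exponents `γ` for which the maximal estimate holds, taken in
the extended reals so that no default value can interfere. -/
noncomputable def gammaBar (n : ℕ) (p : ℝ) : EReal :=
  sInf ((fun γ : ℝ => (γ : EReal)) '' {γ : ℝ | MaximalEstimate n p γ})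

/-- `p₀(n) = 2 + 4/((n-1)(n+2))`, for `n ≥ 2`. -/
noncomputable def p₀ (n : ℕ) : ℝ := 2 + 4 / (((n : ℝ) - 1) * ((n : ℝ) + 2))

/-- `p₁(n) = max_{1 ≤ m ≤ n} (2 + 4/(n-1+m+n/m))`. -/
noncomputable def p₁ (n : ℕ) (hn : 1 ≤ n) : ℝ :=
  (Finset.Icc 1 n).sup' (Finset.nonempty_Icc.2 hn)
    fun m : ℕ => 2 + 4 / ((n : ℝ) - 1 + (m : ℝ) + (n : ℝ) / (m : ℝ))

end SchrodingerMaximal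

namespace SchrodingerMaximal

/-! ### Arithmetic -/

/-! All three claims come from one family of lower bounds. For `n = m + 1` and `0 ≤ k ≤ m`,
`le_gammaBar` bounds γ̄ below by (m+k+2)/(2p) − (m+k+1)/4 + k/(4(k+2)). For k = m this is the
conjectured n(1/p − n/(2(n+1))). For k = n−2 it exceeds that value exactly when p > p₀(n). For k =
l−1 it is positive exactly when p is below the l-th term in the maximum defining p₁(n).

The bound is witnessed by data whose Fourier transform is the indicator of a product set
(`exists_example`). With x large and R ≈ x^(2(k+2)), the factors are: an interval of length ≈
R^(-1/2) starting at 1/(2N) in the first coordinate; in k directions a comb of x^(k+1) teeth of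
width ≈ 1/R; in the other m−k directions an interval of length ≈ R^(-1/2) at the origin. The
solution factors into one-dimensional integrals. At times that are suitable multiples of a/q, with a
coprime to 2q, each comb integral is a quadratic Gauss sum modulo 2q, and it is large when the
coordinate is close to a rational with denominator q (`exists_norm_sum_quadPhase_sub_le`,
`le_norm_setIntegral_comb`).

Dirichlet approximation gives, for at least half of the points in the comb directions, a common
denominator q comparable to x^k (`half_volume_box_le`). The first factor travels at speed 1/N, so
the first coordinate selects the time, that is, the numerator a; coprimality costs only a logarithm
(`le_totient_mul_log_succ`). Hence the maximal function is large on a set of measure about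
R^(1+k+(m−k)/2). Comparing powers of x and letting ε tend to 0 gives the bound. -/

theorem one_div_card_succ_le_prod_one_sub_inv (s : Finset ℕ) (h : ∀ p ∈ s, 2 ≤ p) :
    1 / ((s.card : ℚ) + 1) ≤ ∏ p ∈ s, (1 - (p : ℚ)⁻¹) := by
  induction s using Finset.induction_on_max with
  | empty => simp
  | insert p s hlt ih =>
    have hp : p ∉ s := fun hp => lt_irrefl _ (hlt p hp)
    rw [Finset.prod_insert hp, Finset.card_insert_of_notMem hp]
    have ih' := ih fun q hq => h q (Finset.mem_insert_of_mem hq)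
    have hp2 : 2 ≤ p := h p (Finset.mem_insert_self _ _)
    -- The maximum `p` dominates a subset of [2, p), so the factor 1 − 1/p is at least
    -- (card+1)/(card+2) and the product telescopes.
    have hcard : s.card + 2 ≤ p := by
      have hsub : s ⊆ Finset.Ico 2 p := fun q hq =>
        Finset.mem_Ico.2 ⟨h q (Finset.mem_insert_of_mem hq), hlt q hq⟩
      have := Finset.card_le_card hsub
      rw [Nat.card_Ico] at this
      omega
    have hcq : (s.card : ℚ) + 2 ≤ p := by exact_mod_cast hcard
    have hc0 : (0 : ℚ) ≤ s.card := by positivity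
    have h1 : ((s.card : ℚ) + 1) / (s.card + 2) ≤ 1 - (p : ℚ)⁻¹ := by
      have : (p : ℚ)⁻¹ ≤ ((s.card : ℚ) + 2)⁻¹ := inv_anti₀ (by positivity) hcq
      have e : ((s.card : ℚ) + 1) / (s.card + 2) = 1 - ((s.card : ℚ) + 2)⁻¹ := by
        field_simp; ring
      rw [e]; linarith
    calc 1 / (((s.card + 1 : ℕ) : ℚ) + 1)
        = ((s.card : ℚ) + 1) / (s.card + 2) * (1 / ((s.card : ℚ) + 1)) := by
          push_cast; field_simp; ring
      _ ≤ _ := mul_le_mul h1 ih' (by positivity) (le_trans (by positivity) h1)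

theorem le_totient_mul_log_succ (n : ℕ) : n ≤ n.totient * (Nat.log 2 n + 1) := by
  rcases Nat.eq_zero_or_pos n with rfl | hn
  · simp
  have hcard : n.primeFactors.card ≤ Nat.log 2 n := by
    apply Nat.le_log_of_pow_le (by norm_num)
    calc 2 ^ n.primeFactors.card = ∏ _p ∈ n.primeFactors, 2 := by simp
      _ ≤ ∏ p ∈ n.primeFactors, p :=
        Finset.prod_le_prod' fun p hp => (Nat.prime_of_mem_primeFactors hp).two_le
      _ ≤ n := Nat.le_of_dvd hn (Nat.prod_primeFactors_dvd n)
  have h := one_div_card_succ_le_prod_one_sub_inv n.primeFactors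
    fun p hp => (Nat.prime_of_mem_primeFactors hp).two_le
  have h2 : (1 : ℚ) / ((Nat.log 2 n : ℚ) + 1) ≤ ∏ p ∈ n.primeFactors, (1 - (p : ℚ)⁻¹) := by
    refine le_trans ?_ h
    apply one_div_le_one_div_of_le (by positivity)
    have : (n.primeFactors.card : ℚ) ≤ Nat.log 2 n := by exact_mod_cast hcard
    linarith
  have h3 := Nat.totient_eq_mul_prod_factors n
  have h4 : (n : ℚ) * (1 / ((Nat.log 2 n : ℚ) + 1)) ≤ n.totient := by
    rw [h3]; exact mul_le_mul_of_nonneg_left h2 (by positivity)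
  rw [mul_one_div, div_le_iff₀ (by positivity)] at h4
  exact_mod_cast h4

/-- Simultaneous Dirichlet approximation. -/
theorem exists_simultaneous_approximation {ι : Type*} [Fintype ι] (z : ι → ℝ) {D : ℕ}
    (hD : 0 < D) :
    ∃ q : ℕ, 1 ≤ q ∧ q ≤ D ^ Fintype.card ι ∧ ∃ b : ι → ℤ, ∀ j, |q * z j - b j| < 1 / D := by
  classical
  have hD' : (0 : ℝ) < D := by exact_mod_cast hD
  let box : ℕ → ι → ℕ := fun q j => ⌊Int.fract (q * z j) * D⌋₊
  have hlt : ∀ q j, box q j < D := fun q j => by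
    rw [Nat.floor_lt (by positivity)]
    have := Int.fract_lt_one (q * z j)
    nlinarith
  -- Pigeonhole: the `D ^ card + 1` multiples, `q = 0` included, fall into `D ^ card` cubes of side
  -- 1/D. The difference of two multiples sharing a cube is the required denominator.
  obtain ⟨q, hq, q', hq', hne, heq⟩ := Finset.exists_ne_map_eq_of_card_lt_of_maps_to
    (s := Finset.range (D ^ Fintype.card ι + 1))
    (t := Fintype.piFinset fun _ : ι => Finset.range D) (f := box)
    (by simp) (fun q _ => by simp [hlt])
  wlog hlt' : q < q' generalizing q q'
  · exact this q' hq' q hq hne.symm heq.symm (lt_of_le_of_ne (not_lt.1 hlt') hne.symm)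
  refine ⟨q' - q, by omega, by simp at hq'; omega,
    fun j => ⌊q' * z j⌋ - ⌊q * z j⌋, fun j => ?_⟩
  have hj : ⌊Int.fract (q * z j) * D⌋₊ = ⌊Int.fract (q' * z j) * D⌋₊ := congrFun heq j
  have h1 : |Int.fract (q' * z j) * D - Int.fract (q * z j) * D| < 1 := by
    have a1 := Nat.floor_le (a := Int.fract (q * z j) * D) (by positivity)
    have a2 := Nat.lt_floor_add_one (Int.fract (q * z j) * D)
    have a3 := Nat.floor_le (a := Int.fract (q' * z j) * D) (by positivity)
    have a4 := Nat.lt_floor_add_one (Int.fract (q' * z j) * D)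
    rw [hj] at a1 a2
    rw [abs_lt]; constructor <;> linarith
  rw [← sub_mul, abs_mul, abs_of_pos hD', ← lt_div_iff₀ hD'] at h1
  have e : ((q' - q : ℕ) : ℝ) * z j - ((⌊q' * z j⌋ - ⌊q * z j⌋ : ℤ) : ℝ) =
      Int.fract (q' * z j) - Int.fract (q * z j) := by
    rw [Nat.cast_sub hlt'.le]
    simp only [Int.fract]
    push_cast; ring
  rw [e]; exact h1

/-! ### Exponential sums -/

/-- `e^{ix}`. -/
noncomputable def cis (x : ℝ) : ℂ := Complex.exp (Complex.I * x)

theorem cis_add (x y : ℝ) : cis (x + y) = cis x * cis y := by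
  simp [cis, mul_add, Complex.exp_add]

@[simp] theorem norm_cis (x : ℝ) : ‖cis x‖ = 1 := by
  rw [cis, mul_comm]; exact Complex.norm_exp_ofReal_mul_I x

@[simp] theorem cis_zero : cis 0 = 1 := by simp [cis]

theorem cis_two_pi_mul_int (m : ℤ) : cis (2 * Real.pi * m) = 1 := by
  rw [cis, Complex.exp_eq_one_iff]; exact ⟨m, by push_cast; ring⟩

theorem cis_add_two_pi_mul_int (x : ℝ) (m : ℤ) : cis (x + 2 * Real.pi * m) = cis x := by
  rw [cis_add, cis_two_pi_mul_int, mul_one]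

theorem conj_cis (x : ℝ) : (starRingEnd ℂ) (cis x) = cis (-x) := by
  rw [cis, cis, ← Complex.exp_conj]; simp

theorem cis_natCast_mul (l : ℕ) (x : ℝ) : cis (l * x) = cis x ^ l := by
  rw [cis, cis, ← Complex.exp_nat_mul]; push_cast; ring_nf

theorem norm_cis_sub_one_le (x : ℝ) : ‖cis x - 1‖ ≤ |x| :=
  Real.norm_exp_I_mul_ofReal_sub_one_le

theorem norm_cis_sub_one (x : ℝ) : ‖cis x - 1‖ = 2 * |Real.sin (x / 2)| := by
  rw [cis, Complex.norm_exp_I_mul_ofReal_sub_one]; simp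

theorem continuous_cis : Continuous cis := by unfold cis; fun_prop

theorem sum_range_cis_eq_zero {M : ℕ} (hM : 0 < M) {c : ℤ} (hc : ¬ (M : ℤ) ∣ c) :
    ∑ l ∈ Finset.range M, cis (2 * Real.pi * (c * l / M)) = 0 := by
  have hM' : (M : ℝ) ≠ 0 := by positivity
  have h1 : ∀ l : ℕ, cis (2 * Real.pi * (c * l / M)) = cis (2 * Real.pi * (c / M)) ^ l := by
    intro l; rw [← cis_natCast_mul]; ring_nf
  simp_rw [h1]
  have hne : cis (2 * Real.pi * (c / M)) ≠ 1 := by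
    rw [cis, Ne, Complex.exp_eq_one_iff]
    rintro ⟨m, hm⟩
    apply hc
    refine ⟨m, ?_⟩
    have h2 : ((2 * Real.pi * (c / M) : ℝ) : ℂ) = ((2 * Real.pi * m : ℝ) : ℂ) := by
      apply mul_left_cancel₀ Complex.I_ne_zero
      rw [hm]; push_cast; ring
    have h3 := Complex.ofReal_injective h2
    have h4 : (c : ℝ) / M = m := mul_left_cancel₀ Real.two_pi_pos.ne' h3
    rw [div_eq_iff hM'] at h4
    have : (c : ℝ) = ((M * m : ℤ) : ℝ) := by push_cast; linarith
    exact_mod_cast this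
  rw [geom_sum_eq hne, ← cis_natCast_mul,
    show (M : ℝ) * (2 * Real.pi * (c / M)) = 2 * Real.pi * c by field_simp,
    cis_two_pi_mul_int, sub_self, zero_div]

theorem sum_range_add_eq_of_periodic {f : ℕ → ℂ} {M : ℕ} (hf : ∀ l, f (l + M) = f l) (h : ℕ) :
    ∑ l ∈ Finset.range M, f (l + h) = ∑ l ∈ Finset.range M, f l := by
  induction h with
  | zero => simp
  | succ h ih =>
    rw [← ih]
    have e1 := Finset.sum_range_succ (fun l => f (l + h)) M
    have e2 := Finset.sum_range_succ' (fun l => f (l + h)) M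
    rw [e1] at e2
    have e3 : f (M + h) = f (0 + h) := by rw [zero_add, add_comm, hf]
    rw [e3] at e2
    have := add_right_cancel e2
    rw [this]
    exact Finset.sum_congr rfl fun l _ => by congr 1; ring

/-- The quadratic phase `e^{2πi(al²/(2M) + ml/M)}`. -/
noncomputable def quadPhase (M a : ℕ) (m : ℤ) (l : ℕ) : ℂ :=
  cis (2 * Real.pi * ((a * l ^ 2 / (2 * M) : ℝ) + m * l / M))

/-- Shifting `l` by `M` adds al + aM/2 + m turns, an integer because `M` is even. This is why the
modulus is later taken to be `2 * q`. -/
theorem quadPhase_add_period {M : ℕ} (hM : 0 < M) (hM2 : Even M) (a : ℕ) (m : ℤ) (l : ℕ) :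
    quadPhase M a m (l + M) = quadPhase M a m l := by
  obtain ⟨q, rfl⟩ := hM2
  have hq : (q : ℝ) ≠ 0 := by
    have : 0 < q := by omega
    positivity
  rw [quadPhase, quadPhase,
    ← cis_add_two_pi_mul_int (2 * Real.pi * (_ + m * l / _)) (a * l + a * q + m)]
  congr 1
  push_cast
  field_simp
  ring

/-- Weyl differencing: after expanding the square and shifting one index by the other, the phase is
linear in `l` with frequency ah/M. The sum over `l` vanishes unless M divides ah, which coprimality
reduces to h = 0. -/
theorem norm_sq_sum_quadPhase {M a : ℕ} (hM : 0 < M) (hM2 : Even M) (ha : a.Coprime M) (m : ℤ) :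
    ‖∑ l ∈ Finset.range M, quadPhase M a m l‖ ^ 2 = M := by
  have hM' : (M : ℝ) ≠ 0 := by positivity
  set g := quadPhase M a m with hg
  have hper : ∀ l, g (l + M) = g l := quadPhase_add_period hM hM2 a m
  have key : ∀ l h : ℕ, (starRingEnd ℂ) (g l) * g (h + l) =
      g h * cis (2 * Real.pi * (((a * h : ℕ) : ℤ) * l / M)) := by
    intro l h
    simp only [hg, quadPhase]
    rw [conj_cis, ← cis_add, ← cis_add]
    congr 1
    push_cast
    field_simp
    ring
  have h1 : ((‖∑ l ∈ Finset.range M, g l‖ ^ 2 : ℝ) : ℂ) = M := by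
    rw [Complex.ofReal_pow, ← Complex.conj_mul', map_sum, Finset.sum_mul]
    calc ∑ l ∈ Finset.range M, (starRingEnd ℂ) (g l) * ∑ h ∈ Finset.range M, g h
        = ∑ l ∈ Finset.range M, ∑ h ∈ Finset.range M,
            g h * cis (2 * Real.pi * (((a * h : ℕ) : ℤ) * l / M)) := by
          refine Finset.sum_congr rfl fun l _ => ?_
          rw [← sum_range_add_eq_of_periodic hper l, Finset.mul_sum]
          exact Finset.sum_congr rfl fun h _ => key l h
      _ = ∑ h ∈ Finset.range M, g h *
            ∑ l ∈ Finset.range M, cis (2 * Real.pi * (((a * h : ℕ) : ℤ) * l / M)) := by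
          rw [Finset.sum_comm]; simp_rw [Finset.mul_sum]
      _ = M := by
          rw [Finset.sum_eq_single_of_mem 0 (Finset.mem_range.2 hM)]
          · simp [hg, quadPhase]
          · intro h hh h0
            rw [sum_range_cis_eq_zero hM, mul_zero]
            intro hdvd
            have h2 : M ∣ a * h := by exact_mod_cast hdvd
            have h3 : M ∣ h := (Nat.Coprime.dvd_mul_left ha.symm).1 h2
            exact absurd (Nat.le_of_dvd (Nat.pos_of_ne_zero h0) h3)
              (not_le.2 (Finset.mem_range.1 hh))
  exact_mod_cast h1

theorem norm_sum_quadPhase {M a : ℕ} (hM : 0 < M) (hM2 : Even M) (ha : a.Coprime M) (m : ℤ) :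
    ‖∑ l ∈ Finset.range M, quadPhase M a m l‖ = √M := by
  rw [← norm_sq_sum_quadPhase hM hM2 ha m, Real.sqrt_sq (norm_nonneg _)]

/-- The Dirichlet-type kernel `∑_{l < L} e^{2πiθl}`. -/
noncomputable def expSum (L : ℕ) (θ : ℝ) : ℂ :=
  ∑ l ∈ Finset.range L, cis (2 * Real.pi * (θ * l))

theorem norm_expSum_sub_le (L : ℕ) (θ : ℝ) : ‖expSum L θ - L‖ ≤ 2 * Real.pi * (|θ| * L) * L := by
  have : expSum L θ - L = ∑ l ∈ Finset.range L, (cis (2 * Real.pi * (θ * l)) - 1) := by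
    simp [expSum]
  rw [this]
  refine (norm_sum_le_of_le _ (f := fun l : ℕ => cis (2 * Real.pi * (θ * l)) - 1)
    (n := fun _ => 2 * Real.pi * (|θ| * L)) fun l hl => ?_).trans ?_
  · refine (norm_cis_sub_one_le _).trans ?_
    rw [abs_mul, abs_mul θ, abs_of_pos Real.two_pi_pos, Nat.abs_cast]
    have : (l : ℝ) ≤ L := by exact_mod_cast (Finset.mem_range.1 hl).le
    gcongr
  · simp; linarith

/-- A geometric sum is at most 1/sin(πx). The bound on `θ` keeps x at distance at least c/(2M) from
0 and (M−c)/(2M) from 1; the sum of the two reciprocals covers both halves of (0, 1) and adds up to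
a harmonic sum over `c`. -/
theorem norm_expSum_le {L M c : ℕ} (hc : 0 < c) (hcM : c < M) {θ : ℝ} (hθ : |θ| ≤ 1 / (2 * M)) :
    ‖expSum L (θ + c / M)‖ ≤ M * (1 / c + 1 / (M - c)) := by
  have hM : (0 : ℝ) < M := by exact_mod_cast hc.trans hcM
  have hc' : (1 : ℝ) ≤ c := by exact_mod_cast hc
  have hMc : (1 : ℝ) ≤ M - c := by
    have : (c : ℝ) + 1 ≤ M := by exact_mod_cast hcM
    linarith
  set x := θ + c / M with hx
  obtain ⟨hθ1, hθ2⟩ := abs_le.1 hθ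
  have hx1 : c / (2 * M) ≤ x := by
    have : (c : ℝ) / M = c / (2 * M) + c / (2 * M) := by field_simp; ring
    have h2 : 1 / (2 * (M : ℝ)) ≤ c / (2 * M) := by gcongr
    rw [hx]; linarith
  have hx2 : (M - c) / (2 * M) ≤ 1 - x := by
    have : 1 - (c : ℝ) / M = (M - c) / (2 * M) + (M - c) / (2 * M) := by field_simp; ring
    have h2 : 1 / (2 * (M : ℝ)) ≤ (M - c) / (2 * M) := by gcongr
    rw [hx]; linarith
  have hx0 : 0 < x := lt_of_lt_of_le (by positivity) hx1
  have hx1' : 0 < 1 - x := lt_of_lt_of_le (by positivity) hx2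
  have hpi := Real.pi_pos
  have hsin : 1 / (1 / x + 1 / (1 - x)) ≤ Real.sin (Real.pi * x) / 2 := by
    have hmin : ∀ y : ℝ, 0 < y → y ≤ 1 / 2 → y ≤ Real.sin (Real.pi * y) / 2 := by
      intro y hy hy2
      have := Real.mul_le_sin (x := Real.pi * y) (by positivity) (by nlinarith)
      have e : 2 / Real.pi * (Real.pi * y) = 2 * y := by field_simp
      linarith
    rcases le_total x (1 / 2) with h | h
    · refine le_trans ?_ (hmin x hx0 h)
      rw [div_le_iff₀ (by positivity)]
      have : x * (1 / x) = 1 := by field_simp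
      have : 0 < x * (1 / (1 - x)) := by positivity
      nlinarith
    · have h3 := hmin (1 - x) hx1' (by linarith)
      rw [show Real.pi * (1 - x) = Real.pi - Real.pi * x by ring, Real.sin_pi_sub] at h3
      refine le_trans ?_ h3
      rw [div_le_iff₀ (by positivity)]
      have : (1 - x) * (1 / (1 - x)) = 1 := by field_simp
      have : 0 < (1 - x) * (1 / x) := by positivity
      nlinarith
  have hS : 0 < 1 / x + 1 / (1 - x) := by positivity
  have hsin0 : 0 < Real.sin (Real.pi * x) := by
    have : 0 < 1 / (1 / x + 1 / (1 - x)) := by positivity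
    linarith
  set z := cis (2 * Real.pi * x) with hz
  have hnz : ‖z - 1‖ = 2 * Real.sin (Real.pi * x) := by
    rw [hz, norm_cis_sub_one, show 2 * Real.pi * x / 2 = Real.pi * x by ring, abs_of_pos hsin0]
  have hz1 : z ≠ 1 := fun h => by rw [h] at hnz; simp at hnz; linarith
  have hsum : expSum L x = (z ^ L - 1) / (z - 1) := by
    rw [← geom_sum_eq hz1, expSum]
    refine Finset.sum_congr rfl fun l _ => ?_
    rw [hz, ← cis_natCast_mul]; ring_nf
  have hnum : ‖z ^ L - 1‖ ≤ 2 := by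
    refine (norm_sub_le _ _).trans ?_
    rw [norm_pow, hz, norm_cis]; norm_num
  rw [hsum, norm_div, hnz, div_le_iff₀ (by positivity)]
  have h5 : 1 / x + 1 / (1 - x) ≤ 2 * (M * (1 / c + 1 / (M - c))) := by
    have a1 : 1 / x ≤ 1 / (c / (2 * M)) := one_div_le_one_div_of_le (by positivity) hx1
    have a2 : 1 / (1 - x) ≤ 1 / ((M - c) / (2 * M)) :=
      one_div_le_one_div_of_le (by positivity) hx2
    have : 2 * (M * (1 / c + 1 / ((M : ℝ) - c))) = 1 / (c / (2 * M)) + 1 / ((M - c) / (2 * M)) := by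
      field_simp
    linarith
  have h6 : 1 ≤ (1 / x + 1 / (1 - x)) * (Real.sin (Real.pi * x) / 2) := by
    rw [div_le_iff₀ hS] at hsin; linarith
  nlinarith

theorem sum_norm_expSum_le (L : ℕ) {M : ℕ} (hM : 0 < M) {θ : ℝ} (hθ : |θ| ≤ 1 / (2 * M)) :
    ∑ c ∈ (Finset.range M).erase 0, ‖expSum L (θ + c / M)‖ ≤ 2 * M * (1 + Real.log M) := by
  obtain ⟨N, rfl⟩ : ∃ N, M = N + 1 := ⟨M - 1, by omega⟩
  have himg : (Finset.range (N + 1)).erase 0 = (Finset.range N).image (· + 1) := by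
    ext c
    simp only [Finset.mem_erase, Finset.mem_range, Finset.mem_image]
    exact ⟨fun h => ⟨c - 1, by omega, by omega⟩, fun ⟨i, hi, he⟩ => ⟨by omega, by omega⟩⟩
  rw [himg, Finset.sum_image fun _ _ _ _ h => by simpa using h]
  have hharm : ∑ i ∈ Finset.range N, (1 : ℝ) / ((i + 1 : ℕ) : ℝ) ≤ 1 + Real.log (N + 1 : ℕ) := by
    have h := harmonic_le_one_add_log N
    rw [harmonic] at h
    push_cast at h ⊢
    simp only [one_div]
    refine h.trans ?_
    rcases Nat.eq_zero_or_pos N with rfl | hN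
    · simp
    · gcongr; linarith
  have hrefl : ∑ i ∈ Finset.range N, (1 : ℝ) / (((N + 1 : ℕ) : ℝ) - ((i + 1 : ℕ) : ℝ)) =
      ∑ i ∈ Finset.range N, (1 : ℝ) / ((i + 1 : ℕ) : ℝ) := by
    rw [← Finset.sum_range_reflect]
    refine Finset.sum_congr rfl fun i hi => ?_
    have hi' := Finset.mem_range.1 hi
    rw [← Nat.cast_sub (by omega)]
    congr 2
    omega
  calc _ ≤ ∑ i ∈ Finset.range N, ((N + 1 : ℕ) : ℝ) *
        (1 / ((i + 1 : ℕ) : ℝ) + 1 / (((N + 1 : ℕ) : ℝ) - ((i + 1 : ℕ) : ℝ))) := by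
        refine Finset.sum_le_sum fun i hi => ?_
        exact norm_expSum_le (by omega) (by have := Finset.mem_range.1 hi; omega) hθ
    _ = ((N + 1 : ℕ) : ℝ) * (2 * ∑ i ∈ Finset.range N, (1 : ℝ) / ((i + 1 : ℕ) : ℝ)) := by
        rw [← Finset.mul_sum, Finset.sum_add_distrib, hrefl, two_mul]
    _ ≤ ((N + 1 : ℕ) : ℝ) * (2 * (1 + Real.log (N + 1 : ℕ))) := by gcongr
    _ = _ := by ring

/-- A function of period `M` is the superposition of its discrete Fourier modes. -/
theorem natCast_mul_eq_sum_dft {M : ℕ} (hM : 0 < M) {g : ℕ → ℂ} (hg : ∀ l, g (l + M) = g l)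
    (l : ℕ) :
    M * g l = ∑ c ∈ Finset.range M,
      (∑ r ∈ Finset.range M, g r * cis (2 * Real.pi * (((-c : ℤ) : ℝ) * r / M))) *
        cis (2 * Real.pi * (c / M * l)) := by
  have hM' : (M : ℝ) ≠ 0 := by positivity
  have hlm : g l = g (l % M) := (Function.Periodic.map_mod_nat hg l).symm
  have h1 : ∀ r : ℕ, ∑ c ∈ Finset.range M, cis (2 * Real.pi * ((((l : ℤ) - r : ℤ) : ℝ) * c / M)) =
      if r % M = l % M then (M : ℂ) else 0 := by
    intro r
    split_ifs with h
    · obtain ⟨s, hs⟩ := (Nat.modEq_iff_dvd (n := M)).1 (show r ≡ l [MOD M] from h)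
      calc _ = ∑ c ∈ Finset.range M, (1 : ℂ) := by
            refine Finset.sum_congr rfl fun c _ => ?_
            rw [hs, ← cis_two_pi_mul_int (s * c)]
            congr 1; push_cast; field_simp
        _ = M := by simp
    · apply sum_range_cis_eq_zero hM
      intro hd
      exact h ((Nat.modEq_iff_dvd (n := M)).2 hd)
  calc (M : ℂ) * g l = ∑ r ∈ Finset.range M, g r * (if r % M = l % M then (M : ℂ) else 0) := by
        rw [Finset.sum_eq_single_of_mem (l % M) (Finset.mem_range.2 (Nat.mod_lt _ hM))]
        · rw [if_pos (Nat.mod_mod _ _), hlm, mul_comm]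
        · intro r hr hne
          rw [if_neg, mul_zero]
          rwa [Nat.mod_eq_of_lt (Finset.mem_range.1 hr)]
    _ = ∑ r ∈ Finset.range M, ∑ c ∈ Finset.range M,
          g r * cis (2 * Real.pi * (((-c : ℤ) : ℝ) * r / M)) * cis (2 * Real.pi * (c / M * l)) := by
        refine Finset.sum_congr rfl fun r _ => ?_
        rw [← h1, Finset.mul_sum]
        refine Finset.sum_congr rfl fun c _ => ?_
        rw [mul_assoc (g r), ← cis_add]
        congr 2
        push_cast; ring
    _ = _ := by rw [Finset.sum_comm]; simp_rw [Finset.sum_mul]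

/-- Incomplete quadratic Gauss sums with a slowly varying linear perturbation. -/
theorem exists_norm_sum_quadPhase_sub_le {M a L : ℕ} (hM : 0 < M) (hM2 : Even M)
    (ha : a.Coprime M) (m : ℤ) (hL : 16 * (M * (1 + Real.log M)) ≤ L) :
    ∃ Z : ℂ, ‖Z‖ = L / √M ∧ ∀ θ : ℝ, |θ| * L ≤ 1 / 32 →
      ‖∑ l ∈ Finset.range L, quadPhase M a m l * cis (2 * Real.pi * (θ * l)) - Z‖ ≤
        3 / 8 * ‖Z‖ := by
  have hM' : (0 : ℝ) < M := by exact_mod_cast hM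
  have hM1 : (1 : ℝ) ≤ M := by exact_mod_cast hM
  have hlog : 0 ≤ Real.log M := Real.log_nonneg hM1
  have hLM : 16 * (M : ℝ) ≤ L := by nlinarith
  have hL0 : (0 : ℝ) < L := by linarith
  set g := quadPhase M a m with hg
  have hper : ∀ l, g (l + M) = g l := quadPhase_add_period hM hM2 a m
  -- These Fourier coefficients are complete Gauss sums with `m` replaced by `m - c`, so all have
  -- modulus √M.
  set d : ℕ → ℂ := fun c =>
    ∑ r ∈ Finset.range M, g r * cis (2 * Real.pi * (((-c : ℤ) : ℝ) * r / M)) with hd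
  have hdn : ∀ c, ‖d c‖ = √M := by
    intro c
    rw [← norm_sum_quadPhase hM hM2 ha (m - c), hd]
    congr 1
    refine Finset.sum_congr rfl fun r _ => ?_
    simp only [hg, quadPhase]
    rw [← cis_add]
    congr 1
    push_cast; field_simp; ring
  have hsq : √(M : ℝ) * √M = M := Real.mul_self_sqrt hM'.le
  have hsq0 : 0 < √(M : ℝ) := Real.sqrt_pos.2 hM'
  refine ⟨d 0 * L / M, ?_, fun θ hθ => ?_⟩
  · rw [norm_div, norm_mul, hdn, Complex.norm_natCast, Complex.norm_natCast]
    field_simp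
    nlinarith
  have hZ : ‖d 0 * L / M‖ = √M * L / M := by
    rw [norm_div, norm_mul, hdn, Complex.norm_natCast, Complex.norm_natCast]
  have hθM : |θ| ≤ 1 / (2 * M) := by
    rw [le_div_iff₀ (by positivity)]
    have := abs_nonneg θ
    nlinarith
  have hMc : (M : ℂ) ≠ 0 := by exact_mod_cast hM.ne'
  have hexp : (M : ℂ) * ∑ l ∈ Finset.range L, g l * cis (2 * Real.pi * (θ * l)) =
      ∑ c ∈ Finset.range M, d c * expSum L (θ + c / M) := by
    rw [Finset.mul_sum]
    simp_rw [expSum, Finset.mul_sum]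
    rw [Finset.sum_comm]
    refine Finset.sum_congr rfl fun l _ => ?_
    rw [← mul_assoc, natCast_mul_eq_sum_dft hM hper l, Finset.sum_mul]
    refine Finset.sum_congr rfl fun c _ => ?_
    rw [mul_assoc, ← cis_add]
    congr 2
    ring
  -- Mode 0 yields the main term, with error at most L/4 since 2π/32 ≤ 1/4. The other modes total at
  -- most 2M(1 + log M) ≤ L/8. Together these give 3/8, with `Z` independent of `θ`.
  have hsplit : (M : ℂ) * (∑ l ∈ Finset.range L, g l * cis (2 * Real.pi * (θ * l)) -
      d 0 * L / M) = d 0 * (expSum L θ - L) +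
        ∑ c ∈ (Finset.range M).erase 0, d c * expSum L (θ + c / M) := by
    rw [mul_sub, hexp, mul_div_cancel₀ _ hMc,
      ← Finset.add_sum_erase _ _ (Finset.mem_range.2 hM)]
    simp only [Nat.cast_zero, zero_div, add_zero]
    ring
  have hmain : ‖d 0 * (expSum L θ - L)‖ ≤ √M * (L / 4) := by
    rw [norm_mul, hdn]
    gcongr
    refine (norm_expSum_sub_le L θ).trans ?_
    have := Real.pi_lt_four
    have h1 : 2 * Real.pi * (|θ| * L) ≤ 2 * 4 * (1 / 32) := by
      have := Real.pi_pos
      gcongr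
    nlinarith
  have herr : ‖∑ c ∈ (Finset.range M).erase 0, d c * expSum L (θ + c / M)‖ ≤ √M * (L / 8) := by
    refine (norm_sum_le _ _).trans ?_
    simp_rw [norm_mul, hdn]
    rw [← Finset.mul_sum]
    gcongr
    refine (sum_norm_expSum_le L hM hθM).trans ?_
    linarith
  have hfin := (norm_add_le _ _).trans (add_le_add hmain herr)
  rw [← hsplit, norm_mul, Complex.norm_natCast] at hfin
  rw [hZ, show 3 / 8 * (√(M : ℝ) * L / M) = (√M * (L / 4) + √M * (L / 8)) / M by ring,
    le_div_iff₀ hM']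
  linarith

/-! ### Data whose Fourier transform is an indicator function -/

open scoped Pointwise in
theorem exists_schrodinger_eq_setIntegral {n : ℕ} {S : Set (EuclideanSpace ℝ (Fin n))}
    (hS : MeasurableSet S) (hball : S ⊆ Metric.ball 0 1) :
    ∃ f : Lp ℂ 2 (volume : Measure (EuclideanSpace ℝ (Fin n))),
      FourierSupportedInUnitBall f ∧ ‖f‖ = volume.real S ^ (1 / 2 : ℝ) ∧
      ∀ t x, schrodinger f t x = (((2 * Real.pi) ^ (-(n : ℝ) / 2) : ℝ) : ℂ) *
        ∫ ξ in S, cis (inner ℝ x ξ + t * ‖ξ‖ ^ 2) := by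
  have h2pi := Real.two_pi_pos
  have hr : (2 * Real.pi)⁻¹ ≠ 0 := (inv_pos.2 h2pi).ne'
  set T : Set (EuclideanSpace ℝ (Fin n)) := (2 * Real.pi)⁻¹ • S with hT
  have hTm : MeasurableSet T := hS.const_smul₀ _
  have hvT : volume.real T = ((2 * Real.pi)⁻¹) ^ n * volume.real S := by
    rw [hT, measureReal_def, Measure.addHaar_smul_of_nonneg _ (inv_pos.2 h2pi).le,
      ENNReal.toReal_mul, ENNReal.toReal_ofReal (by positivity), finrank_euclideanSpace_fin,
      measureReal_def]
  have hSfin : volume S ≠ ∞ := ((measure_mono hball).trans_lt measure_ball_lt_top).ne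
  have hTfin : volume T ≠ ∞ := by
    rw [hT, Measure.addHaar_smul_of_nonneg _ (inv_pos.2 h2pi).le]
    exact ENNReal.mul_ne_top ENNReal.ofReal_ne_top hSfin
  set c : ℝ := (2 * Real.pi) ^ ((n : ℝ) / 2) with hc
  have hc0 : 0 < c := by positivity
  have hcc : (2 * Real.pi) ^ (-(n : ℝ) / 2) * c = 1 := by
    rw [hc, ← Real.rpow_add h2pi]; ring_nf; simp
  -- The height `c` on `S/(2π)` cancels the normalising factor in `hat`, so that the transform is
  -- exactly the indicator of `S`.
  set G : Lp ℂ 2 (volume : Measure (EuclideanSpace ℝ (Fin n))) :=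
    indicatorConstLp 2 hTm hTfin (c : ℂ) with hG
  set f : Lp ℂ 2 (volume : Measure (EuclideanSpace ℝ (Fin n))) :=
    (Lp.fourierTransformₗᵢ (EuclideanSpace ℝ (Fin n)) ℂ).symm G with hf
  have hFf : (𝓕 f : Lp ℂ 2 (volume : Measure (EuclideanSpace ℝ (Fin n)))) = G :=
    (Lp.fourierTransformₗᵢ (EuclideanSpace ℝ (Fin n)) ℂ).apply_symm_apply G
  have hhat : hat f =ᵐ[volume] S.indicator fun _ => (1 : ℂ) := by
    have h1 : ∀ᵐ η : EuclideanSpace ℝ (Fin n), G η = T.indicator (fun _ => (c : ℂ)) η :=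
      indicatorConstLp_coeFn
    have h2 := (Measure.quasiMeasurePreserving_smul
      (volume : Measure (EuclideanSpace ℝ (Fin n))) hr).ae h1
    filter_upwards [h2] with ξ hξ
    rw [hat, hFf]
    rw [hξ]
    have hmem : (2 * Real.pi)⁻¹ • ξ ∈ T ↔ ξ ∈ S := by
      rw [hT, Set.smul_mem_smul_set_iff₀ hr]
    by_cases h : ξ ∈ S
    · rw [Set.indicator_of_mem (hmem.2 h), Set.indicator_of_mem h]
      exact_mod_cast hcc
    · rw [Set.indicator_of_notMem (fun h' => h (hmem.1 h')), Set.indicator_of_notMem h, mul_zero]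
  refine ⟨f, ?_, ?_, fun t x => ?_⟩
  · filter_upwards [hhat] with ξ hξ hball'
    rw [hξ, Set.indicator_of_notMem fun h => hball' (hball h)]
  · rw [hf, LinearIsometryEquiv.norm_map, hG, norm_indicatorConstLp (by norm_num) (by norm_num),
      hvT, Complex.norm_real, Real.norm_of_nonneg hc0.le]
    simp only [ENNReal.toReal_ofNat]
    rw [Real.mul_rpow (by positivity) measureReal_nonneg, ← mul_assoc, ← Real.rpow_natCast,
      Real.inv_rpow h2pi.le, Real.inv_rpow (by positivity), ← Real.rpow_mul h2pi.le, hc,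
      mul_one_div, mul_inv_cancel₀ (by positivity), one_mul]
  · rw [schrodinger]
    congr 1
    rw [← integral_indicator hS]
    refine integral_congr_ae ?_
    filter_upwards [hhat] with ξ hξ
    rw [hξ]
    by_cases h : ξ ∈ S <;> simp [h, cis]

/-- The phase is a sum over the coordinates, so the integral over a product set factors. The
condition |ξ_j| < 1/n puts the product inside the unit ball. -/
theorem exists_schrodinger_eq_prod {n : ℕ} (hn : 0 < n) {S : Fin n → Set ℝ}
    (hS : ∀ j, MeasurableSet (S j)) (hsub : ∀ j, ∀ ξ ∈ S j, |ξ| < 1 / n) :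
    ∃ f : Lp ℂ 2 (volume : Measure (EuclideanSpace ℝ (Fin n))),
      FourierSupportedInUnitBall f ∧ ‖f‖ = (∏ j, volume.real (S j)) ^ (1 / 2 : ℝ) ∧
      ∀ t x, ‖schrodinger f t x‖ = (2 * Real.pi) ^ (-(n : ℝ) / 2) *
        ∏ j, ‖∫ ξ in S j, cis (x j * ξ + t * ξ ^ 2)‖ := by
  have hn' : (0 : ℝ) < n := by exact_mod_cast hn
  have hP : MeasurableSet (Set.univ.pi S) := MeasurableSet.univ_pi hS
  have hmp := EuclideanSpace.volume_preserving_symm_measurableEquiv_toLp (Fin n)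
  set E := (MeasurableEquiv.toLp 2 (Fin n → ℝ)).symm ⁻¹' (Set.univ.pi S) with hE
  have hEm : MeasurableSet E := (MeasurableEquiv.measurable _) hP
  have hball : E ⊆ Metric.ball 0 1 := by
    intro ξ hξ
    have hξ' : ∀ j, |ξ j| < 1 / n := fun j => hsub j _ (hξ j (Set.mem_univ j))
    rw [mem_ball_zero_iff, ← sq_lt_one_iff₀ (norm_nonneg _), EuclideanSpace.real_norm_sq_eq]
    have : ∀ j ∈ Finset.univ, ξ j ^ 2 < 1 / n := fun j _ => by
      have h1 : (1 : ℝ) / n ≤ 1 := by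
        rw [div_le_one hn']; exact_mod_cast hn
      have h2 := hξ' j
      have h3 := abs_nonneg (ξ j)
      rw [← sq_abs]
      nlinarith
    have : Nonempty (Fin n) := ⟨⟨0, hn⟩⟩
    calc ∑ j, ξ j ^ 2 < ∑ _j : Fin n, (1 : ℝ) / n :=
          Finset.sum_lt_sum_of_nonempty Finset.univ_nonempty ‹_›
      _ = 1 := by simp [hn'.ne']
  obtain ⟨f, h1, h2, h3⟩ := exists_schrodinger_eq_setIntegral hEm hball
  refine ⟨f, h1, ?_, fun t x => ?_⟩
  · rw [h2, measureReal_def, hE, hmp.measure_preimage hP.nullMeasurableSet, volume_pi_pi,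
      ENNReal.toReal_prod]
    rfl
  · rw [h3, norm_mul, Complex.norm_real, Real.norm_of_nonneg (by positivity), ← norm_prod]
    congr 2
    have h4 : ∫ ξ in E, cis (inner ℝ x ξ + t * ‖ξ‖ ^ 2) =
        ∫ y in Set.univ.pi S, ∏ j, cis (x j * y j + t * y j ^ 2) := by
      rw [hE, ← hmp.setIntegral_preimage_emb (MeasurableEquiv.measurableEmbedding _)]
      refine setIntegral_congr_fun hEm fun ξ _ => ?_
      have : ∀ s : Finset (Fin n), ∀ u : Fin n → ℝ, ∏ j ∈ s, cis (u j) = cis (∑ j ∈ s, u j) := by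
        intro s u
        induction s using Finset.induction_on with
        | empty => simp
        | insert a s ha ih => rw [Finset.prod_insert ha, Finset.sum_insert ha, cis_add, ih]
      simp only [this, Finset.sum_add_distrib, ← Finset.mul_sum]
      rw [EuclideanSpace.real_norm_sq_eq, PiLp.inner_apply]
      simp [mul_comm]
    rw [h4, ← integral_indicator hP]
    simp_rw [← integral_indicator (hS _)]
    rw [← integral_fintype_prod_volume_eq_prod
      (fun j => (S j).indicator fun ξ => cis (x j * ξ + t * ξ ^ 2))]
    refine integral_congr_ae (Filter.Eventually.of_forall fun y => ?_)
    by_cases h : y ∈ Set.univ.pi S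
    · rw [Set.indicator_of_mem h]
      refine Finset.prod_congr rfl fun j _ => ?_
      rw [Set.indicator_of_mem (h j (Set.mem_univ j))]
    · rw [Set.indicator_of_notMem h]
      obtain ⟨j, hj⟩ : ∃ j, y j ∉ S j := by simpa using h
      exact (Finset.prod_eq_zero (Finset.mem_univ j) (Set.indicator_of_notMem hj _)).symm

/-! ### One-dimensional oscillatory integrals -/

theorem mul_norm_le_norm_intervalIntegral {h : ℝ → ℂ} (hh : Continuous h) {δ : ℝ} (hδ : 0 ≤ δ)
    {Z : ℂ} (hZ : ∀ u, 0 ≤ u → u ≤ δ → ‖h u - Z‖ ≤ ‖Z‖ / 2) :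
    δ / 2 * ‖Z‖ ≤ ‖∫ u in (0)..δ, h u‖ := by
  have h1 : ‖∫ u in (0)..δ, (h u - Z)‖ ≤ ‖Z‖ / 2 * |δ - 0| := by
    refine intervalIntegral.norm_integral_le_of_norm_le_const fun u hu => ?_
    rw [Set.uIoc_of_le hδ] at hu
    exact hZ u hu.1.le hu.2
  rw [intervalIntegral.integral_sub (hh.intervalIntegrable _ _) (by simp),
    intervalIntegral.integral_const, sub_zero, abs_of_nonneg hδ] at h1
  have h2 := norm_sub_norm_le (δ • Z) (∫ u in (0)..δ, h u)
  rw [norm_sub_rev, norm_smul, Real.norm_of_nonneg hδ] at h2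
  linarith

theorem setIntegral_Ioc_cis (a ρ x t : ℝ) (hρ : 0 ≤ ρ) :
    ∫ ξ in Set.Ioc a (a + ρ), cis (x * ξ + t * ξ ^ 2) =
      ∫ u in (0)..ρ, cis (x * (a + u) + t * (a + u) ^ 2) := by
  rw [← intervalIntegral.integral_of_le (by linarith),
    intervalIntegral.integral_comp_add_left (fun ξ => cis (x * ξ + t * ξ ^ 2)) a, add_zero]

/-- Centred at `a`, the phase has linear coefficient x + 2ta and quadratic coefficient t; when it
varies by at most 1/2 there is no cancellation. -/
theorem half_le_norm_setIntegral_Ioc {a δ x t : ℝ} (hδ : 0 ≤ δ)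
    (h : |x + 2 * t * a| * δ + |t| * δ ^ 2 ≤ 1 / 2) :
    δ / 2 ≤ ‖∫ ξ in Set.Ioc a (a + δ), cis (x * ξ + t * ξ ^ 2)‖ := by
  rw [setIntegral_Ioc_cis _ _ _ _ hδ]
  have hc : Continuous fun u => cis (x * (a + u) + t * (a + u) ^ 2) :=
    continuous_cis.comp (by fun_prop)
  have := mul_norm_le_norm_intervalIntegral hc hδ (Z := cis (x * a + t * a ^ 2))
    fun u hu0 hu => ?_
  · simpa using this
  · have e : cis (x * (a + u) + t * (a + u) ^ 2) - cis (x * a + t * a ^ 2) =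
        cis (x * a + t * a ^ 2) * (cis ((x + 2 * t * a) * u + t * u ^ 2) - 1) := by
      rw [mul_sub, ← cis_add, mul_one]; ring_nf
    rw [e, norm_mul, norm_cis, one_mul]
    refine (norm_cis_sub_one_le _).trans ((abs_add_le _ _).trans (le_trans ?_ h))
    rw [abs_mul, abs_mul, abs_of_nonneg hu0, abs_of_nonneg (sq_nonneg u)]
    gcongr

/-- The union of `L` intervals of length `ρ` with left end points in `σ ℕ`. -/
def comb (L : ℕ) (σ ρ : ℝ) : Set ℝ := ⋃ l ∈ Finset.range L, Set.Ioc (σ * l) (σ * l + ρ)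

theorem measurableSet_comb (L : ℕ) (σ ρ : ℝ) : MeasurableSet (comb L σ ρ) :=
  Finset.measurableSet_biUnion _ fun _ _ => measurableSet_Ioc

theorem pairwiseDisjoint_comb (L : ℕ) {σ ρ : ℝ} (hσ : 0 ≤ σ) (hρσ : ρ ≤ σ) :
    Set.PairwiseDisjoint (Finset.range L : Set ℕ)
      fun l : ℕ => Set.Ioc (σ * l) (σ * l + ρ) := by
  have key : ∀ a b : ℕ, a < b → Disjoint (Set.Ioc (σ * a) (σ * a + ρ))
      (Set.Ioc (σ * b) (σ * b + ρ)) := fun a b hab => by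
    rw [Set.disjoint_left]
    rintro y ⟨_, h1⟩ ⟨h2, _⟩
    have : (a : ℝ) + 1 ≤ b := by exact_mod_cast hab
    nlinarith
  intro a _ b _ hab
  rcases lt_or_gt_of_ne hab with h | h
  · exact key a b h
  · exact (key b a h).symm

theorem volume_real_comb_le (L : ℕ) {σ ρ : ℝ} (hρ : 0 ≤ ρ) :
    volume.real (comb L σ ρ) ≤ L * ρ := by
  refine (measureReal_biUnion_finset_le _ _).trans ?_
  simp [hρ]

/-- With ξ = σl + u, each offset `u` in a tooth gives an incomplete Gauss sum in `l`. All these sums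
stay near the same `Z`, so integrating over `u` loses only a factor 2. -/
theorem le_norm_setIntegral_comb {M a L : ℕ} (hM : 0 < M) (hM2 : Even M) (ha : a.Coprime M)
    (m : ℤ) (hL : 16 * (M * (1 + Real.log M)) ≤ L) {σ ρ x t : ℝ} (hσ : 0 ≤ σ) (hρ : 0 ≤ ρ)
    (hρσ : ρ ≤ σ) (ht : t * σ ^ 2 = 2 * Real.pi * (a / (2 * M)))
    (hx : |x * σ / (2 * Real.pi) - m / M| * L ≤ 1 / 64)
    (htρ : |t| * ρ * σ / Real.pi * L ≤ 1 / 64) (hxρ : |x| * ρ + |t| * ρ ^ 2 ≤ 1 / 16) :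
    ρ / 2 * (L / √M) ≤ ‖∫ ξ in comb L σ ρ, cis (x * ξ + t * ξ ^ 2)‖ := by
  have hpi := Real.pi_pos
  have hcont : Continuous fun ξ => cis (x * ξ + t * ξ ^ 2) := continuous_cis.comp (by fun_prop)
  obtain ⟨Z, hZ, hZ'⟩ := exists_norm_sum_quadPhase_sub_le hM hM2 ha m hL
  have hcont2 : ∀ l : ℕ, Continuous fun u => cis (x * (σ * l + u) + t * (σ * l + u) ^ 2) :=
    fun l => continuous_cis.comp (by fun_prop)
  have hsum : ∫ ξ in comb L σ ρ, cis (x * ξ + t * ξ ^ 2) =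
      ∫ u in (0)..ρ, ∑ l ∈ Finset.range L, cis (x * (σ * l + u) + t * (σ * l + u) ^ 2) := by
    rw [comb, integral_biUnion_finset _ (fun _ _ => measurableSet_Ioc)
      (pairwiseDisjoint_comb L hσ hρσ)
      (fun _ _ => (hcont.integrableOn_Icc).mono_set Set.Ioc_subset_Icc_self),
      intervalIntegral.integral_finsetSum fun l _ => (hcont2 l).intervalIntegrable _ _]
    exact Finset.sum_congr rfl fun l _ => setIntegral_Ioc_cis _ _ _ _ hρ
  rw [hsum, ← hZ]
  refine mul_norm_le_norm_intervalIntegral (continuous_finsetSum _ fun l _ => hcont2 l) hρ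
    fun u hu0 hu => ?_
  -- The linear perturbation combines the distance of the position from m/M with the cross term
  -- 2tσlu.
  set θ : ℝ := (x * σ / (2 * Real.pi) - m / M) + t * u * σ / Real.pi with hθ
  have hθL : |θ| * L ≤ 1 / 32 := by
    have h1 : |t * u * σ / Real.pi| ≤ |t| * ρ * σ / Real.pi := by
      rw [abs_div, abs_mul, abs_mul, abs_of_nonneg hu0, abs_of_nonneg hσ, abs_of_pos hpi]
      gcongr
    calc |θ| * L ≤ (|x * σ / (2 * Real.pi) - m / M| + |t| * ρ * σ / Real.pi) * L := by
          gcongr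
          exact (abs_add_le _ _).trans (by gcongr)
      _ ≤ 1 / 32 := by rw [add_mul]; linarith
  set G := ∑ l ∈ Finset.range L, quadPhase M a m l * cis (2 * Real.pi * (θ * l)) with hG
  have hGZ : ‖G - Z‖ ≤ 3 / 8 * ‖Z‖ := hZ' θ hθL
  have hfac : ∑ l ∈ Finset.range L, cis (x * (σ * l + u) + t * (σ * l + u) ^ 2) =
      cis (x * u + t * u ^ 2) * G := by
    rw [hG, Finset.mul_sum]
    refine Finset.sum_congr rfl fun l _ => ?_
    rw [quadPhase, ← cis_add, ← cis_add]
    congr 1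
    have e1 : 2 * Real.pi * ((a * l ^ 2 / (2 * M) : ℝ) + m * l / M) =
        t * σ ^ 2 * l ^ 2 + 2 * Real.pi * (m * l / M) := by rw [ht]; ring
    have e2 : 2 * Real.pi * (θ * l) =
        x * σ * l - 2 * Real.pi * (m * l / M) + 2 * t * u * σ * l := by
      rw [hθ]; field_simp
    rw [e1, e2]; ring
  have hw : ‖cis (x * u + t * u ^ 2) - 1‖ ≤ 1 / 16 := by
    refine (norm_cis_sub_one_le _).trans ((abs_add_le _ _).trans (le_trans ?_ hxρ))
    rw [abs_mul, abs_mul, abs_of_nonneg hu0, abs_of_nonneg (sq_nonneg u)]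
    gcongr
  have hGn : ‖G‖ ≤ 11 / 8 * ‖Z‖ := by
    have := norm_sub_norm_le G Z
    linarith
  -- The error budget is 1/16 · 11/8 + 3/8 = 59/128, below the 1/2 required.
  rw [hfac, show cis (x * u + t * u ^ 2) * G - Z = (cis (x * u + t * u ^ 2) - 1) * G + (G - Z) by
    ring]
  refine (norm_add_le _ _).trans ?_
  rw [norm_mul]
  have : ‖cis (x * u + t * u ^ 2) - 1‖ * ‖G‖ ≤ 1 / 16 * (11 / 8 * ‖Z‖) := by gcongr
  have := norm_nonneg Z
  linarith

/-! ### Measures of sets of approximable points -/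

/-- Tonelli: over every point of the union of the `A q`, the slice contains an entire `B q`. -/
theorem mul_measure_biUnion_le_prod {α β ι : Type*} [MeasurableSpace α] [MeasurableSpace β]
    {μ : Measure α} {ν : Measure β} [SFinite μ] [SFinite ν] (T : Finset ι) {B : ι → Set α}
    {A : ι → Set β} (hB : ∀ q, MeasurableSet (B q)) (hA : ∀ q, MeasurableSet (A q)) {c : ℝ≥0∞}
    (hc : ∀ q ∈ T, c ≤ μ (B q)) :
    c * ν (⋃ q ∈ T, A q) ≤ (μ.prod ν) (⋃ q ∈ T, B q ×ˢ A q) := by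
  have hU : MeasurableSet (⋃ q ∈ T, A q) := Finset.measurableSet_biUnion _ fun q _ => hA q
  have hG : MeasurableSet (⋃ q ∈ T, B q ×ˢ A q) :=
    Finset.measurableSet_biUnion _ fun q _ => (hB q).prod (hA q)
  rw [Measure.prod_apply_symm hG, ← lintegral_indicator_const hU]
  refine lintegral_mono fun y => ?_
  by_cases hy : y ∈ ⋃ q ∈ T, A q
  · rw [Set.indicator_of_mem hy]
    obtain ⟨q, hq, hyq⟩ := Set.mem_iUnion₂.1 hy
    exact (hc q hq).trans (measure_mono fun x hx => Set.mem_iUnion₂.2 ⟨q, hq, hx, hyq⟩)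
  · rw [Set.indicator_of_notMem hy]; exact zero_le

/-- The points `x ∈ [0, H)` for which `q x / P` is within `1 / D` of an integer. -/
def approxSet (P H : ℝ) (D q : ℕ) : Set ℝ :=
  Set.Ico 0 H ∩ ⋃ b : ℤ, {x | |q * (x / P) - b| < 1 / D}

theorem measurableSet_approxSet (P H : ℝ) (D q : ℕ) : MeasurableSet (approxSet P H D q) :=
  measurableSet_Ico.inter <| MeasurableSet.iUnion fun _ =>
    (isOpen_lt (by fun_prop) continuous_const).measurableSet

theorem volume_approxSet_le {P H : ℝ} (hP : 0 < P) (hPH : P ≤ H) {D q : ℕ} (hD : 0 < D)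
    (hq : 0 < q) : volume (approxSet P H D q) ≤ ENNReal.ofReal (8 * H / D) := by
  have hD' : (1 : ℝ) ≤ D := by exact_mod_cast hD
  have hq' : (1 : ℝ) ≤ q := by exact_mod_cast hq
  have hD0 : (0 : ℝ) < D := by linarith
  have hq0 : (0 : ℝ) < q := by linarith
  have hH : 0 < H := hP.trans_le hPH
  set B := ⌈q * (H / P)⌉₊ + 1 with hB
  -- At most 3qH/P intervals of length 2P/(qD) are involved, so the final bound does not depend on
  -- `q`.
  have hsub : approxSet P H D q ⊆ ⋃ b ∈ Finset.range B,
      Set.Ioo (((b : ℝ) - 1 / D) * P / q) (((b : ℝ) + 1 / D) * P / q) := by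
    rintro x ⟨⟨hx0, hxH⟩, hx⟩
    obtain ⟨b, hb⟩ := Set.mem_iUnion.1 hx
    have hb' : |q * (x / P) - b| < 1 / D := hb
    obtain ⟨hb1, hb2⟩ := abs_lt.1 hb'
    have hD1 : 1 / (D : ℝ) ≤ 1 := by rw [div_le_one hD0]; exact hD'
    have hxP : 0 ≤ q * (x / P) := by positivity
    have hbnn : 0 ≤ b := by
      have : (-1 : ℝ) < b := by linarith
      have : -1 < b := by exact_mod_cast this
      omega
    obtain ⟨b, rfl⟩ := Int.eq_ofNat_of_zero_le hbnn
    simp only [Int.cast_natCast] at hb1 hb2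
    refine Set.mem_iUnion₂.2 ⟨b, Finset.mem_range.2 ?_, ?_, ?_⟩
    · have h1 : q * (x / P) < q * (H / P) := by gcongr
      have h2 := Nat.le_ceil (q * (H / P))
      have : (b : ℝ) < B := by rw [hB]; push_cast; linarith
      exact_mod_cast this
    · have : x = q * (x / P) * P / q := by field_simp
      rw [this]; gcongr; linarith
    · have : x = q * (x / P) * P / q := by field_simp
      conv_lhs => rw [this]
      gcongr; linarith
  refine (measure_mono hsub).trans ((measure_biUnion_finset_le _ _).trans ?_)
  simp only [Real.volume_Ioo]
  have e : ∀ b : ℕ, ((b : ℝ) + 1 / D) * P / q - ((b : ℝ) - 1 / D) * P / q = 2 * P / (q * D) := by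
    intro b; field_simp; ring
  simp only [e, Finset.sum_const, Finset.card_range, nsmul_eq_mul]
  rw [← ENNReal.ofReal_natCast, ← ENNReal.ofReal_mul (by positivity)]
  apply ENNReal.ofReal_le_ofReal
  have hB' : (B : ℝ) ≤ 3 * (q * (H / P)) := by
    have h1 := Nat.ceil_lt_add_one (a := q * (H / P)) (by positivity)
    have h2 : 1 ≤ H / P := by rw [le_div_iff₀ hP]; linarith
    have h3 : 1 ≤ q * (H / P) := by nlinarith
    rw [hB]; push_cast; linarith
  calc B * (2 * P / (q * D)) ≤ 3 * (q * (H / P)) * (2 * P / (q * D)) := by gcongr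
    _ = 6 * H / D := by field_simp; ring
    _ ≤ 8 * H / D := by gcongr; norm_num

section ApproxBox

variable {ι : Type*} [Fintype ι] [DecidableEq ι]

/-- The box points all of whose coordinates in `J` are approximable with denominator `q`. -/
def approxBox (J : Finset ι) (P H w : ℝ) (D q : ℕ) : Set (ι → ℝ) :=
  Set.univ.pi fun j => if j ∈ J then approxSet P H D q else Set.Ico 0 w

theorem measurableSet_approxBox (J : Finset ι) (P H w : ℝ) (D q : ℕ) :
    MeasurableSet (approxBox J P H w D q) :=
  MeasurableSet.univ_pi fun j => by
    split_ifs
    · exact measurableSet_approxSet _ _ _ _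
    · exact measurableSet_Ico

theorem prod_ite_mem_const {M : Type*} [CommMonoid M] (J : Finset ι) (a b : M) :
    ∏ j, (if j ∈ J then a else b) = a ^ J.card * b ^ (Fintype.card ι - J.card) := by
  rw [Finset.prod_ite, Finset.prod_const, Finset.prod_const, Finset.filter_mem_eq_inter,
    Finset.univ_inter, ← Finset.card_compl]
  congr 3
  ext; simp

theorem volume_approxBox_le {J : Finset ι} {P H w : ℝ} (hP : 0 < P) (hPH : P ≤ H) {D q : ℕ}
    (hD : 0 < D) (hq : 0 < q) :
    volume (approxBox J P H w D q) ≤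
      ENNReal.ofReal (8 * H / D) ^ J.card * ENNReal.ofReal w ^ (Fintype.card ι - J.card) := by
  rw [approxBox, volume_pi_pi, ← prod_ite_mem_const]
  refine Finset.prod_le_prod' fun j _ => ?_
  split_ifs
  · exact volume_approxSet_le hP hPH hD hq
  · simp

/-- Most points of a box have a good approximation whose denominator is not small. -/
theorem half_volume_box_le {J : Finset ι} {P H w : ℝ} (hP : 0 < P) (hPH : P ≤ H) (hw : 0 ≤ w)
    {D Q : ℕ} (hD : 0 < D) (hQ : 2 * 8 ^ J.card * Q ≤ D ^ J.card) :
    ENNReal.ofReal (H ^ J.card * w ^ (Fintype.card ι - J.card) / 2) ≤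
      volume (⋃ q ∈ Finset.Ioc Q (D ^ J.card), approxBox J P H w D q) := by
  have hH : 0 < H := hP.trans_le hPH
  have hD' : (0 : ℝ) < D := by exact_mod_cast hD
  set Box : Set (ι → ℝ) := Set.univ.pi fun j => if j ∈ J then Set.Ico 0 H else Set.Ico 0 w
  set v : ℝ := H ^ J.card * w ^ (Fintype.card ι - J.card) with hv
  have hv0 : 0 ≤ v := by positivity
  have hBox : volume Box = ENNReal.ofReal v := by
    rw [volume_pi_pi, hv, ENNReal.ofReal_mul (by positivity), ENNReal.ofReal_pow hH.le,
      ENNReal.ofReal_pow hw, ← prod_ite_mem_const]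
    refine Finset.prod_congr rfl fun j _ => ?_
    split_ifs <;> simp
  have hcover : Box ⊆ (⋃ q ∈ Finset.Ioc Q (D ^ J.card), approxBox J P H w D q) ∪
      ⋃ q ∈ Finset.Ioc 0 Q, approxBox J P H w D q := by
    intro z hz
    obtain ⟨q, hq1, hqD, b, hb⟩ :=
      exists_simultaneous_approximation (fun j : J => z j / P) hD
    rw [Fintype.card_coe] at hqD
    have hzq : z ∈ approxBox J P H w D q := by
      intro j _
      have hzj := hz j (Set.mem_univ j)
      by_cases hj : j ∈ J
      · simp only [hj, if_true] at hzj ⊢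
        exact ⟨hzj, Set.mem_iUnion.2 ⟨b ⟨j, hj⟩, hb ⟨j, hj⟩⟩⟩
      · simpa only [hj, if_false] using hzj
    rcases le_or_gt q Q with h | h
    · exact Or.inr (Set.mem_iUnion₂.2 ⟨q, Finset.mem_Ioc.2 ⟨hq1, h⟩, hzq⟩)
    · exact Or.inl (Set.mem_iUnion₂.2 ⟨q, Finset.mem_Ioc.2 ⟨h, hqD⟩, hzq⟩)
  -- Each `q` accounts for a proportion at most (8/D)^|J| of the box, so denominators up to `Q`
  -- cover at most half of it.
  have hsmall : volume (⋃ q ∈ Finset.Ioc 0 Q, approxBox J P H w D q) ≤ ENNReal.ofReal (v / 2) := by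
    refine (measure_biUnion_finset_le _ _).trans ?_
    refine (Finset.sum_le_sum fun q hq =>
      volume_approxBox_le hP hPH hD (Finset.mem_Ioc.1 hq).1).trans ?_
    rw [Finset.sum_const, Nat.card_Ioc, nsmul_eq_mul, ← ENNReal.ofReal_natCast,
      ← ENNReal.ofReal_pow (by positivity), ← ENNReal.ofReal_pow hw,
      ← ENNReal.ofReal_mul (by positivity), ← ENNReal.ofReal_mul (by positivity)]
    apply ENNReal.ofReal_le_ofReal
    have hQ' : 2 * (8 : ℝ) ^ J.card * Q ≤ D ^ J.card := by exact_mod_cast hQ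
    have hDk : (0 : ℝ) < D ^ J.card := by positivity
    calc ((Q - 0 : ℕ) : ℝ) * ((8 * H / D) ^ J.card * w ^ (Fintype.card ι - J.card))
        = (2 * 8 ^ J.card * Q / D ^ J.card) * (v / 2) := by
          rw [hv, div_pow, mul_pow, Nat.sub_zero]; field_simp
      _ ≤ 1 * (v / 2) := by
          gcongr
          rw [div_le_one hDk]; exact hQ'
      _ = v / 2 := one_mul _
  have h1 := (measure_mono hcover).trans (measure_union_le _ _) |>.trans (add_le_add_right hsmall _)
  rw [hBox, ← add_halves v, ENNReal.ofReal_add (by positivity) (by positivity), add_halves v]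
    at h1
  exact (ENNReal.add_le_add_iff_right ENNReal.ofReal_ne_top).1 h1

end ApproxBox

theorem card_filter_coprime_Ico (a m Y : ℕ) :
    ((Finset.Ico m (m + a * Y)).filter a.Coprime).card = Y * a.totient := by
  induction Y with
  | zero => simp
  | succ Y ih =>
    have h1 : Finset.Ico m (m + a * (Y + 1)) =
        Finset.Ico m (m + a * Y) ∪ Finset.Ico (m + a * Y) (m + a * Y + a) := by
      rw [Finset.Ico_union_Ico_eq_Ico (by omega) (by omega)]; congr 1; ring
    rw [h1, Finset.filter_union, Finset.card_union_of_disjoint, ih,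
      Nat.filter_coprime_Ico_eq_totient]
    · ring
    · exact Finset.disjoint_filter_filter (Finset.Ico_disjoint_Ico_consecutive _ _ _)

/-- The union of the intervals `[-s(a+1), -sa)` with `1 ≤ a ≤ 2qY` coprime to `2q`. -/
def coprimeSet (s : ℝ) (q Y : ℕ) : Set ℝ :=
  ⋃ a ∈ (Finset.Ico 1 (1 + 2 * q * Y)).filter (2 * q).Coprime,
    Set.Ico (-(s * ((a : ℝ) + 1))) (-(s * a))

theorem measurableSet_coprimeSet (s : ℝ) (q Y : ℕ) : MeasurableSet (coprimeSet s q Y) :=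
  Finset.measurableSet_biUnion _ fun _ _ => measurableSet_Ico

theorem volume_coprimeSet {s : ℝ} (hs : 0 ≤ s) (q Y : ℕ) :
    volume (coprimeSet s q Y) = ENNReal.ofReal (Y * (2 * q).totient * s) := by
  rw [coprimeSet, measure_biUnion_finset]
  · have e : ∀ a : ℕ, -(s * (a : ℝ)) - -(s * ((a : ℝ) + 1)) = s := fun a => by ring
    simp only [Real.volume_Ico, e, Finset.sum_const, card_filter_coprime_Ico, nsmul_eq_mul]
    rw [← ENNReal.ofReal_natCast, ← ENNReal.ofReal_mul (by positivity)]
    push_cast; rfl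
  · have key : ∀ a b : ℕ, a < b → Disjoint (Set.Ico (-(s * ((a : ℝ) + 1))) (-(s * a)))
        (Set.Ico (-(s * ((b : ℝ) + 1))) (-(s * b))) := fun a b hab => by
      rw [Set.disjoint_left]
      rintro y ⟨h1, _⟩ ⟨_, h2⟩
      have : (a : ℝ) + 1 ≤ b := by exact_mod_cast hab
      nlinarith
    intro a _ b _ hab
    rcases lt_or_gt_of_ne hab with h | h
    · exact key a b h
    · exact (key b a h).symm
  · exact fun _ _ => measurableSet_Ico

/-! ### The example at a fixed scale

The scale is given by the dimension `N`, a large parameter `x` and a power `u` of `x`. -/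

/-- The radius of the ball. -/
noncomputable def exRadius (N x u : ℝ) : ℝ := 64 * N ^ 2 * (u * x ^ 2) ^ 2

/-- The width of the frequency intervals in the non-lattice directions. -/
noncomputable def exWidth (N x u : ℝ) : ℝ := 1 / (32 * N * (u * x ^ 2))

/-- The spacing of the frequency lattice. -/
noncomputable def exSpacing (N x u : ℝ) : ℝ := 1 / (2 * N * (u * x))

/-- The width of the frequency intervals in the lattice directions. -/
noncomputable def exCombWidth (N x u : ℝ) : ℝ := 1 / (16 * exRadius N x u)

/-- The time at which the datum is large. -/
noncomputable def exTime (N x u : ℝ) (q a : ℕ) : ℝ := 2 * Real.pi * N ^ 2 * (u * x) ^ 2 * a / q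

/-- The distance travelled between consecutive times. -/
noncomputable def exStep (N x u : ℝ) (q : ℕ) : ℝ := 2 * Real.pi * N * (u * x) ^ 2 / q

section Coordinates

variable {N x u : ℝ}

theorem exRadius_pos (hN : 1 ≤ N) (hx : 1 ≤ x) (hu : 1 ≤ u) : 0 < exRadius N x u := by
  unfold exRadius; positivity

theorem exWidth_pos (hN : 1 ≤ N) (hx : 1 ≤ x) (hu : 1 ≤ u) : 0 < exWidth N x u := by
  unfold exWidth; positivity

theorem exCombWidth_pos (hN : 1 ≤ N) (hx : 1 ≤ x) (hu : 1 ≤ u) : 0 < exCombWidth N x u :=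
  one_div_pos.2 (mul_pos (by norm_num) (exRadius_pos hN hx hu))

theorem exSpacing_pos (hN : 1 ≤ N) (hx : 1 ≤ x) (hu : 1 ≤ u) : 0 < exSpacing N x u := by
  unfold exSpacing; positivity

theorem le_exRadius (hN : 1 ≤ N) (hx : 1 ≤ x) (hu : 1 ≤ u) : 64 ≤ exRadius N x u := by
  have h1 : 1 ≤ (u * x ^ 2) ^ 2 := one_le_pow₀ (one_le_mul_of_one_le_of_one_le hu (one_le_pow₀ hx))
  have h2 : 1 ≤ N ^ 2 := one_le_pow₀ hN
  unfold exRadius; nlinarith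

theorem exCombWidth_le_exSpacing (hN : 1 ≤ N) (hx : 1 ≤ x) (hu : 1 ≤ u) :
    exCombWidth N x u ≤ exSpacing N x u := by
  unfold exCombWidth exSpacing exRadius
  apply one_div_le_one_div_of_le (by positivity)
  have h1 : u * x ≤ u * x ^ 2 := by
    nlinarith [mul_nonneg (by linarith : 0 ≤ u) (by linarith : 0 ≤ x)]
  have h2 : 1 ≤ u * x ^ 2 := one_le_mul_of_one_le_of_one_le hu (one_le_pow₀ hx)
  have h3 : u * x ^ 2 ≤ (u * x ^ 2) ^ 2 := by nlinarith
  have h4 : N ≤ N ^ 2 := by nlinarith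
  calc 2 * N * (u * x) ≤ 2 * N ^ 2 * (u * x ^ 2) ^ 2 := by gcongr; linarith
    _ ≤ 16 * (64 * N ^ 2 * (u * x ^ 2) ^ 2) := by
      have : 0 ≤ N ^ 2 * (u * x ^ 2) ^ 2 := by positivity
      nlinarith

theorem exTime_pos (hN : 1 ≤ N) (hx : 1 ≤ x) (hu : 1 ≤ u) {q a : ℕ} (hq : 0 < q) (ha : 0 < a) :
    0 < exTime N x u q a := by
  have := Real.pi_pos
  unfold exTime; positivity

theorem exTime_le (hN : 1 ≤ N) (hx : 1 ≤ x) (hu : 1 ≤ u) {q a : ℕ} (hq : 0 < q)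
    (ha : (a : ℝ) ≤ 2 * q * x ^ 2) : exTime N x u q a ≤ exRadius N x u / 4 := by
  have hq' : (0 : ℝ) < q := by exact_mod_cast hq
  have := Real.pi_pos
  have := Real.pi_lt_four
  unfold exTime exRadius
  rw [div_le_iff₀ hq']
  calc 2 * Real.pi * N ^ 2 * (u * x) ^ 2 * a ≤ 2 * 4 * N ^ 2 * (u * x) ^ 2 * (2 * q * x ^ 2) := by
        gcongr
    _ = _ := by ring

theorem exStep_nonneg (hN : 1 ≤ N) (q : ℕ) : 0 ≤ exStep N x u q := by
  have := Real.pi_pos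
  unfold exStep; positivity

theorem exStep_le (hN : 1 ≤ N) (hx : 1 ≤ x) (hu : 1 ≤ u) {q : ℕ} (hq : u ≤ 2 * q) :
    exStep N x u q ≤ 4 * Real.pi * N * (u * x ^ 2) := by
  have hq' : (0 : ℝ) < q := by linarith
  have := Real.pi_pos
  unfold exStep
  rw [div_le_iff₀ hq']
  calc 2 * Real.pi * N * (u * x) ^ 2 = 2 * Real.pi * N * u * x ^ 2 * u := by ring
    _ ≤ 2 * Real.pi * N * u * x ^ 2 * (2 * q) := by gcongr
    _ = _ := by ring

theorem exWidth_sq_mul (hN : 1 ≤ N) (hx : 1 ≤ x) (hu : 1 ≤ u) :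
    exRadius N x u * exWidth N x u ^ 2 = 1 / 16 := by
  unfold exRadius exWidth; field_simp; norm_num

theorem exTime_mul_exWidth_sq_le (hN : 1 ≤ N) (hx : 1 ≤ x) (hu : 1 ≤ u) {q a : ℕ} (hq : 0 < q)
    (ha0 : 0 < a) (ha : (a : ℝ) ≤ 2 * q * x ^ 2) :
    |exTime N x u q a| * exWidth N x u ^ 2 ≤ 1 / 64 := by
  rw [abs_of_pos (exTime_pos hN hx hu hq ha0)]
  have h1 := exWidth_sq_mul hN hx hu
  have h2 := mul_le_mul_of_nonneg_right (exTime_le hN hx hu hq ha) (sq_nonneg (exWidth N x u))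
  linarith

/-- The choice of `exStep` makes t/N equal to `exStep * a`, so y + t/N is at most one step in size.
A step times the width is at most π/8, which with the quadratic part 1/64 stays below 1/2. -/
theorem half_exWidth_le_first (hN : 1 ≤ N) (hx : 1 ≤ x) (hu : 1 ≤ u) {q a : ℕ}
    (hq : u ≤ 2 * q) (ha0 : 0 < a) (ha : (a : ℝ) ≤ 2 * q * x ^ 2) {y : ℝ}
    (hy : y ∈ Set.Ico (-(exStep N x u q * ((a : ℝ) + 1))) (-(exStep N x u q * a))) :
    exWidth N x u / 2 ≤ ‖∫ ξ in Set.Ioc (1 / (2 * N)) (1 / (2 * N) + exWidth N x u),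
      cis (y * ξ + exTime N x u q a * ξ ^ 2)‖ := by
  have hq' : (0 : ℝ) < q := by linarith
  have hqn : 0 < q := by exact_mod_cast hq'
  refine half_le_norm_setIntegral_Ioc (exWidth_pos hN hx hu).le ?_
  have e : 2 * exTime N x u q a * (1 / (2 * N)) = exStep N x u q * a := by
    unfold exTime exStep; field_simp
  have h1 : |y + 2 * exTime N x u q a * (1 / (2 * N))| ≤ 4 * Real.pi * N * (u * x ^ 2) := by
    have hs := exStep_le hN hx hu hq
    have hs0 := exStep_nonneg (x := x) (u := u) hN q
    rw [e, abs_le]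
    obtain ⟨h1, h2⟩ := hy
    constructor <;> nlinarith
  have h2 := exTime_mul_exWidth_sq_le hN hx hu hqn ha0 ha
  have h3 : 4 * Real.pi * N * (u * x ^ 2) * exWidth N x u = Real.pi / 8 := by
    unfold exWidth; field_simp; norm_num
  have h4 := mul_le_mul_of_nonneg_right h1 (exWidth_pos hN hx hu).le
  have := Real.pi_lt_d2
  linarith

theorem half_exWidth_le_rest (hN : 1 ≤ N) (hx : 1 ≤ x) (hu : 1 ≤ u) {q a : ℕ}
    (hq : u ≤ 2 * q) (ha0 : 0 < a) (ha : (a : ℝ) ≤ 2 * q * x ^ 2) {y : ℝ}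
    (hy : y ∈ Set.Ico 0 (u * x ^ 2)) :
    exWidth N x u / 2 ≤ ‖∫ ξ in Set.Ioc 0 (exWidth N x u),
      cis (y * ξ + exTime N x u q a * ξ ^ 2)‖ := by
  have hq' : (0 : ℝ) < q := by linarith
  have hqn : 0 < q := by exact_mod_cast hq'
  have := half_le_norm_setIntegral_Ioc (a := 0) (x := y) (t := exTime N x u q a)
    (exWidth_pos hN hx hu).le ?_
  · simpa using this
  have h2 := exTime_mul_exWidth_sq_le hN hx hu hqn ha0 ha
  have h3 : u * x ^ 2 * exWidth N x u ≤ 1 / 32 := by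
    unfold exWidth
    rw [mul_one_div, div_le_div_iff₀ (by positivity) (by norm_num)]
    have : 0 < u * x ^ 2 := by positivity
    nlinarith
  have h4 := mul_le_mul_of_nonneg_right hy.2.le (exWidth_pos hN hx hu).le
  rw [mul_zero, add_zero, abs_of_nonneg hy.1]
  linarith

theorem exCombWidth_le_lattice (hN : 1 ≤ N) (hx : 1 ≤ x) (hu : 1 ≤ u) {q a L D : ℕ}
    (hq : u ≤ 2 * q) (ha0 : 0 < a) (ha : (a : ℝ) ≤ 2 * q * x ^ 2) (hcop : (2 * q).Coprime a)
    (hL : (L : ℝ) = u * x) (hD : (D : ℝ) = 128 * x) {B : ℝ} (hB : 2 * q ≤ B)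
    (hbig : 16 * (B * (1 + Real.log B)) ≤ u * x) {y : ℝ}
    (hy : y ∈ approxSet (4 * Real.pi * N * (u * x)) ((u * x ^ 2) ^ 2) D q) :
    exCombWidth N x u / 2 * (u * x / √B) ≤
      ‖∫ ξ in comb L (exSpacing N x u) (exCombWidth N x u),
        cis (y * ξ + exTime N x u q a * ξ ^ 2)‖ := by
  have hq' : (0 : ℝ) < q := by linarith
  have hqn : 0 < q := by exact_mod_cast hq'
  have hpi := Real.pi_pos
  obtain ⟨⟨hy0, hyH⟩, hyb⟩ := hy
  obtain ⟨b, hb⟩ := Set.mem_iUnion.1 hyb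
  have hb' : |q * (y / (4 * Real.pi * N * (u * x))) - b| < 1 / D := hb
  have hR := le_exRadius hN hx hu
  have hR0 : 0 < exRadius N x u := by linarith
  have hρ := exCombWidth_pos hN hx hu
  have ht := exTime_le hN hx hu hqn ha
  have ht0 := exTime_pos hN hx hu hqn ha0
  have hρR : exRadius N x u * exCombWidth N x u = 1 / 16 := by
    unfold exCombWidth; field_simp
  have htρ : exTime N x u q a * exCombWidth N x u ≤ 1 / 64 := by
    have := mul_le_mul_of_nonneg_right ht hρ.le
    linarith
  have hσL : exSpacing N x u * L = 1 / (2 * N) := by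
    rw [hL]; unfold exSpacing; field_simp
  have hq1 : (1 : ℝ) ≤ q := by exact_mod_cast hqn
  have hB1 : 1 ≤ B := by linarith
  have hM : ((2 * q : ℕ) : ℝ) ≤ B := by push_cast; exact hB
  have hM0 : (0 : ℝ) < (2 * q : ℕ) := by push_cast; positivity
  have hM1 : (1 : ℝ) ≤ (2 * q : ℕ) := by push_cast; linarith
  -- Since yσ/(2π) is close to b/q, and the modulus is 2q, the integer is `2 * b`. The error 1/(Dq),
  -- over `L = u * x` teeth with `D = 128 * x`, is u/(128q) ≤ 1/64.
  have key := le_norm_setIntegral_comb (M := 2 * q) (a := a) (L := L) (by omega) ⟨q, by ring⟩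
    hcop.symm (2 * b) ?_ (exSpacing_pos hN hx hu).le hρ.le (exCombWidth_le_exSpacing hN hx hu)
    (x := y) (t := exTime N x u q a) ?_ ?_ ?_ ?_
  · refine le_trans ?_ key
    rw [hL]
    gcongr
  · rw [hL]
    refine le_trans ?_ hbig
    have := Real.log_nonneg hM1
    gcongr
  · unfold exTime exSpacing
    push_cast
    field_simp
  · have e : y * exSpacing N x u / (2 * Real.pi) - ((2 * b : ℤ) : ℝ) / ((2 * q : ℕ) : ℝ) =
        (q * (y / (4 * Real.pi * N * (u * x))) - b) / q := by
      unfold exSpacing; push_cast; field_simp; ring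
    rw [e, abs_div, abs_of_pos hq', div_mul_eq_mul_div, div_le_iff₀ hq', hL]
    have hux : 0 < u * x := by positivity
    calc _ ≤ 1 / D * (u * x) := by gcongr
      _ = u / 128 := by rw [hD]; field_simp
      _ ≤ _ := by linarith
  · rw [abs_of_pos ht0]
    calc exTime N x u q a * exCombWidth N x u * exSpacing N x u / Real.pi * L
        = exTime N x u q a * exCombWidth N x u * (exSpacing N x u * L) / Real.pi := by ring
      _ ≤ 1 / 64 * (1 / 1) / 1 := by
          rw [hσL]
          gcongr
          · linarith
          · linarith [Real.pi_gt_three]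
      _ = 1 / 64 := by norm_num
  · rw [abs_of_nonneg hy0, abs_of_pos ht0]
    have hH : (u * x ^ 2) ^ 2 ≤ exRadius N x u / 64 := by
      unfold exRadius
      have : 1 ≤ N ^ 2 := one_le_pow₀ hN
      have : 0 ≤ (u * x ^ 2) ^ 2 := by positivity
      nlinarith
    have h1 : y * exCombWidth N x u ≤ exRadius N x u / 64 * exCombWidth N x u := by
      gcongr; linarith
    have hρ1 : exCombWidth N x u ≤ 1 := by nlinarith
    have h2 : exTime N x u q a * exCombWidth N x u ^ 2 ≤ 1 / 64 := by
      rw [sq, ← mul_assoc]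
      have : 0 ≤ exTime N x u q a * exCombWidth N x u := by positivity
      nlinarith
    linarith

end Coordinates

/-! ### The frequency set -/

section Frequency

variable {m : ℕ}

/-- The frequency sets in the separate coordinates: an interval away from the origin in the
first one, a comb in the directions of `J`, and an interval at the origin in the others. -/
noncomputable def exFreq (J : Finset (Fin m)) (L : ℕ) (N x u : ℝ) : Fin (m + 1) → Set ℝ :=
  Fin.cons (Set.Ioc (1 / (2 * N)) (1 / (2 * N) + exWidth N x u))
    fun j => if j ∈ J then comb L (exSpacing N x u) (exCombWidth N x u)
      else Set.Ioc 0 (exWidth N x u)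

theorem exFreq_zero (J : Finset (Fin m)) (L : ℕ) (N x u : ℝ) :
    exFreq J L N x u 0 = Set.Ioc (1 / (2 * N)) (1 / (2 * N) + exWidth N x u) := rfl

theorem exFreq_succ (J : Finset (Fin m)) (L : ℕ) (N x u : ℝ) (j : Fin m) :
    exFreq J L N x u j.succ = if j ∈ J then comb L (exSpacing N x u) (exCombWidth N x u)
      else Set.Ioc 0 (exWidth N x u) := rfl

theorem measurableSet_exFreq (J : Finset (Fin m)) (L : ℕ) (N x u : ℝ) (j : Fin (m + 1)) :
    MeasurableSet (exFreq J L N x u j) := by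
  revert j
  refine Fin.cases measurableSet_Ioc fun j => ?_
  rw [exFreq_succ]; split_ifs
  · exact measurableSet_comb _ _ _
  · exact measurableSet_Ioc

theorem abs_lt_of_mem_exFreq {N x u : ℝ} (hN : 1 ≤ N) (hx : 1 ≤ x) (hu : 1 ≤ u)
    {J : Finset (Fin m)} {L : ℕ} (hL : (L : ℝ) = u * x) (j : Fin (m + 1)) :
    ∀ ξ ∈ exFreq J L N x u j, |ξ| < 1 / N := by
  have hN0 : 0 < N := by linarith
  have hσ0 := exSpacing_pos hN hx hu
  have hρσ := exCombWidth_le_exSpacing hN hx hu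
  have hδ : exWidth N x u ≤ 1 / (32 * N) := by
    unfold exWidth
    apply one_div_le_one_div_of_le (by positivity)
    have : 1 ≤ u * x ^ 2 := one_le_mul_of_one_le_of_one_le hu (one_le_pow₀ hx)
    nlinarith
  have h2N : 1 / (2 * N) + 1 / (32 * N) < 1 / N := by
    have : 1 / (2 * N) + 1 / (32 * N) = 17 / 32 * (1 / N) := by field_simp; norm_num
    rw [this]; have : 0 < 1 / N := by positivity
    linarith
  have hfN : 0 < 1 / (2 * N) := by positivity
  have hgN : 0 < 1 / (32 * N) := by positivity
  revert j
  refine Fin.cases (fun ξ hξ => ?_) fun j ξ hξ => ?_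
  · obtain ⟨h1, h2⟩ := hξ
    rw [abs_of_pos (by linarith)]; linarith
  · rw [exFreq_succ] at hξ
    split_ifs at hξ
    · obtain ⟨l, hl, h1, h2⟩ := Set.mem_iUnion₂.1 hξ
      have hl1 : (l : ℝ) + 1 ≤ L := by exact_mod_cast Finset.mem_range.1 hl
      have hσL : exSpacing N x u * L = 1 / (2 * N) := by
        rw [hL]; unfold exSpacing; field_simp
      have h3 : 0 ≤ exSpacing N x u * (l : ℝ) := by positivity
      rw [abs_of_pos (by linarith)]; nlinarith
    · obtain ⟨h1, h2⟩ := hξ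
      rw [abs_of_pos h1]; linarith

theorem prod_ite_mem_fin {J : Finset (Fin m)} {k : ℕ} (hJ : J.card = k) (a b : ℝ) :
    ∏ j : Fin m, (if j ∈ J then a else b) = a ^ k * b ^ (m - k) := by
  rw [prod_ite_mem_const, hJ, Fintype.card_fin]

theorem prod_volume_exFreq_le {N x u : ℝ} (hN : 1 ≤ N) (hx : 1 ≤ x) (hu : 1 ≤ u)
    {J : Finset (Fin m)} {k L : ℕ} (hJ : J.card = k) (hL : (L : ℝ) = u * x) :
    ∏ j, volume.real (exFreq J L N x u j) ≤
      exWidth N x u * ((u * x * exCombWidth N x u) ^ k * exWidth N x u ^ (m - k)) := by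
  have hδ0 := (exWidth_pos hN hx hu).le
  rw [Fin.prod_univ_succ, exFreq_zero, ← prod_ite_mem_fin hJ]
  refine mul_le_mul ?_ ?_ (Finset.prod_nonneg fun _ _ => measureReal_nonneg) hδ0
  · simp [hδ0]
  · refine Finset.prod_le_prod (fun _ _ => measureReal_nonneg) fun j _ => ?_
    rw [exFreq_succ]
    split_ifs
    · rw [← hL]; exact volume_real_comb_le L (exCombWidth_pos hN hx hu).le
    · simp [hδ0]

end Frequency

/-! ### The set where the maximal function is large -/

section LargeSet

variable {m : ℕ}

/-- The set where the maximal function is large, as a subset of `ℝ × ℝᵐ`. -/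
noncomputable def exSet (J : Finset (Fin m)) (N x u : ℝ) (A D Q Q' : ℕ) :
    Set (ℝ × (Fin m → ℝ)) :=
  ⋃ q ∈ Finset.Ioc Q Q', coprimeSet (exStep N x u q) q (A ^ 2) ×ˢ
    approxBox J (4 * Real.pi * N * (u * x)) ((u * x ^ 2) ^ 2) (u * x ^ 2) D q

theorem measurableSet_exSet (J : Finset (Fin m)) (N x u : ℝ) (A D Q Q' : ℕ) :
    MeasurableSet (exSet J N x u A D Q Q') :=
  Finset.measurableSet_biUnion _ fun _ _ =>
    (measurableSet_coprimeSet _ _ _).prod (measurableSet_approxBox _ _ _ _ _ _)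

/-- The splitting `ℝ^(m+1) = ℝ × ℝᵐ`. -/
def splitFirst (m : ℕ) : EuclideanSpace ℝ (Fin (m + 1)) → ℝ × (Fin m → ℝ) :=
  MeasurableEquiv.piFinSuccAbove (fun _ : Fin (m + 1) => ℝ) 0 ∘
    (MeasurableEquiv.toLp 2 (Fin (m + 1) → ℝ)).symm

theorem measurePreserving_splitFirst (m : ℕ) : MeasurePreserving (splitFirst m) :=
  (volume_preserving_piFinSuccAbove (fun _ : Fin (m + 1) => ℝ) 0).comp
    (EuclideanSpace.volume_preserving_symm_measurableEquiv_toLp (Fin (m + 1)))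

theorem exists_of_mem_exSet {J : Finset (Fin m)} {N x u : ℝ} {A D Q Q' : ℕ} (hx : x = A)
    {y : EuclideanSpace ℝ (Fin (m + 1))} (hy : splitFirst m y ∈ exSet J N x u A D Q Q') :
    ∃ q ∈ Finset.Ioc Q Q', ∃ a : ℕ, 0 < a ∧ (a : ℝ) ≤ 2 * q * x ^ 2 ∧ (2 * q).Coprime a ∧
      y 0 ∈ Set.Ico (-(exStep N x u q * ((a : ℝ) + 1))) (-(exStep N x u q * a)) ∧
      ∀ j : Fin m, y j.succ ∈ if j ∈ J then
        approxSet (4 * Real.pi * N * (u * x)) ((u * x ^ 2) ^ 2) D q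
          else Set.Ico 0 (u * x ^ 2) := by
  obtain ⟨q, hq, hyq1, hyq2⟩ := Set.mem_iUnion₂.1 hy
  obtain ⟨a, ha, hya⟩ := Set.mem_iUnion₂.1 hyq1
  obtain ⟨ha1, ha2⟩ := Finset.mem_filter.1 ha
  obtain ⟨ha3, ha4⟩ := Finset.mem_Ico.1 ha1
  refine ⟨q, hq, a, ha3, ?_, ha2, hya, fun j => hyq2 j (Set.mem_univ j)⟩
  have : a ≤ 2 * q * A ^ 2 := by omega
  rw [hx]; exact_mod_cast this

theorem norm_lt_exRadius {J : Finset (Fin m)} {N x u : ℝ} (hNm : N = (m : ℝ) + 1) (hx : 1 ≤ x)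
    (hu : 1 ≤ u) {A D Q Q' : ℕ} (hxA : x = A) {y : EuclideanSpace ℝ (Fin (m + 1))}
    (hy : splitFirst m y ∈ exSet J N x u A D Q Q') : ‖y‖ < exRadius N x u := by
  have hN : 1 ≤ N := by rw [hNm]; linarith [(Nat.cast_nonneg m : (0 : ℝ) ≤ m)]
  have hN0 : 0 < N := by linarith
  have hR0 := exRadius_pos hN hx hu
  obtain ⟨q, hq, a, ha0, ha, -, hy0, hys⟩ := exists_of_mem_exSet hxA hy
  have hq0 : 0 < q := by have := Finset.mem_Ioc.1 hq; omega
  have hw1 : 1 ≤ u * x ^ 2 := one_le_mul_of_one_le_of_one_le hu (one_le_pow₀ hx)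
  have hww : u * x ^ 2 ≤ (u * x ^ 2) ^ 2 := by nlinarith
  have hw2 : 0 < (u * x ^ 2) ^ 2 := by positivity
  have hwN : (u * x ^ 2) ^ 2 ≤ N * (u * x ^ 2) ^ 2 := by nlinarith
  have hcoord : ∀ j, |y j| ≤ 33 * (N * (u * x ^ 2) ^ 2) := by
    refine Fin.cases ?_ fun j => ?_
    · have hs := exStep_nonneg (x := x) (u := u) hN q
      have hq' : (0 : ℝ) < q := by exact_mod_cast hq0
      have ha1 : (1 : ℝ) ≤ a := by exact_mod_cast ha0
      have h1 : exStep N x u q * (2 * a) ≤ 32 * (N * (u * x ^ 2) ^ 2) := by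
        unfold exStep
        rw [div_mul_eq_mul_div, div_le_iff₀ hq']
        have := Real.pi_lt_four
        calc 2 * Real.pi * N * (u * x) ^ 2 * (2 * a)
            ≤ 2 * 4 * N * (u * x) ^ 2 * (2 * (2 * q * x ^ 2)) := by gcongr
          _ = _ := by ring
      have h2 : exStep N x u q * ((a : ℝ) + 1) ≤ exStep N x u q * (2 * a) := by
        gcongr; linarith
      have h3 : 0 ≤ exStep N x u q * a := by positivity
      obtain ⟨h5, h6⟩ := hy0
      rw [abs_le]
      constructor <;> linarith
    · have := hys j
      split_ifs at this
      · obtain ⟨⟨h1, h2⟩, -⟩ := this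
        rw [abs_of_nonneg h1]; linarith
      · obtain ⟨h1, h2⟩ := this
        rw [abs_of_nonneg h1]; linarith
  have hRN : ∀ c, |c| ≤ 33 * (N * (u * x ^ 2) ^ 2) → c ^ 2 < exRadius N x u ^ 2 / N := by
    intro c hc
    have h1 : c ^ 2 ≤ (33 * (N * (u * x ^ 2) ^ 2)) ^ 2 := by rw [← sq_abs]; gcongr
    refine h1.trans_lt ?_
    rw [lt_div_iff₀ hN0]; unfold exRadius
    have h2 : N ≤ N ^ 2 := by nlinarith
    have h3 : 0 < (N ^ 2 * (u * x ^ 2) ^ 2) ^ 2 := by positivity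
    calc (33 * (N * (u * x ^ 2) ^ 2)) ^ 2 * N ≤ (33 * (N * (u * x ^ 2) ^ 2)) ^ 2 * N ^ 2 := by
          gcongr
      _ = 1089 * (N ^ 2 * (u * x ^ 2) ^ 2) ^ 2 := by ring
      _ < 4096 * (N ^ 2 * (u * x ^ 2) ^ 2) ^ 2 := by linarith
      _ = _ := by ring
  rw [← abs_of_pos hR0, ← abs_of_nonneg (norm_nonneg y), ← sq_lt_sq,
    EuclideanSpace.real_norm_sq_eq]
  calc ∑ j, y j ^ 2 < ∑ _j : Fin (m + 1), exRadius N x u ^ 2 / N :=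
        Finset.sum_lt_sum_of_nonempty Finset.univ_nonempty fun j _ => hRN _ (hcoord j)
    _ = exRadius N x u ^ 2 := by
        rw [Finset.sum_const, Finset.card_univ, Fintype.card_fin, nsmul_eq_mul,
          show ((m + 1 : ℕ) : ℝ) = N by rw [hNm]; push_cast; rfl]
        field_simp

/-- For each `q` the admissible first coordinates have measure x²·φ(2q)·`exStep`. As `exStep * q` is
independent of `q`, the totient bound makes this uniform in `q`, and Tonelli combines it with the
half-box estimate. -/
theorem le_volume_exSet {J : Finset (Fin m)} {k : ℕ} (hJ : J.card = k) {N x u : ℝ} (hN : 1 ≤ N)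
    (hx : 1 ≤ x) (hu : 1 ≤ u) {A D Q : ℕ} (hxA : x = A) (hNx : 4 * Real.pi * N ≤ x)
    (hD : 0 < D) (hQ : 2 * 8 ^ k * Q ≤ D ^ k) :
    ENNReal.ofReal (4 * Real.pi * N * (u * x ^ 2) ^ 2 / (Nat.log 2 (2 * D ^ k) + 1) *
      (((u * x ^ 2) ^ 2) ^ k * (u * x ^ 2) ^ (m - k) / 2)) ≤
        volume (exSet J N x u A D Q (D ^ k)) := by
  have hpi := Real.pi_pos
  have hPH : 4 * Real.pi * N * (u * x) ≤ (u * x ^ 2) ^ 2 := by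
    calc 4 * Real.pi * N * (u * x) ≤ x * (u * x) := by gcongr
      _ ≤ x * (u * x) * (u * x ^ 2) := by
        apply le_mul_of_one_le_right (by positivity)
        exact one_le_mul_of_one_le_of_one_le hu (one_le_pow₀ hx)
      _ = _ := by ring
  have hbox := half_volume_box_le (J := J) (Q := Q) (P := 4 * Real.pi * N * (u * x))
    (w := u * x ^ 2) (by positivity) hPH (by positivity) hD (by rw [hJ]; exact hQ)
  rw [hJ, Fintype.card_fin] at hbox
  rw [ENNReal.ofReal_mul (by positivity)]
  refine (mul_le_mul_right hbox _).trans ?_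
  refine mul_measure_biUnion_le_prod _ (fun q => measurableSet_coprimeSet _ _ _)
    (fun q => measurableSet_approxBox _ _ _ _ _ _) fun q hq => ?_
  obtain ⟨hq1, hq2⟩ := Finset.mem_Ioc.1 hq
  have hq0 : 0 < q := by omega
  rw [volume_coprimeSet (exStep_nonneg hN q)]
  apply ENNReal.ofReal_le_ofReal
  have hq' : (0 : ℝ) < q := by exact_mod_cast hq0
  rw [div_le_iff₀ (by positivity)]
  have h1 : 2 * q ≤ (2 * q).totient * (Nat.log 2 (2 * D ^ k) + 1) := by
    refine (le_totient_mul_log_succ (2 * q)).trans ?_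
    gcongr
  have h2 : 2 * (q : ℝ) ≤ (2 * q).totient * (Nat.log 2 (2 * D ^ k) + 1) := by exact_mod_cast h1
  have hs : exStep N x u q * q = 2 * Real.pi * N * (u * x) ^ 2 := by
    unfold exStep; field_simp
  have hs0 := exStep_nonneg (x := x) (u := u) hN q
  calc 4 * Real.pi * N * (u * x ^ 2) ^ 2 = x ^ 2 * (exStep N x u q * (2 * q)) := by
        rw [show exStep N x u q * (2 * q) = 2 * (exStep N x u q * q) by ring, hs]; ring
    _ ≤ x ^ 2 * (exStep N x u q * ((2 * q).totient * (Nat.log 2 (2 * D ^ k) + 1))) := by gcongr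
    _ = _ := by rw [hxA]; push_cast; ring

theorem le_prod_norm_integral_of_mem_exSet {J : Finset (Fin m)} {k : ℕ} (hJ : J.card = k)
    {N x u : ℝ} (hN : 1 ≤ N) (hx : 1 ≤ x) (hu : 1 ≤ u) {A L D Q Q' : ℕ} (hxA : x = A)
    (hL : (L : ℝ) = u * x) (hD : (D : ℝ) = 128 * x) {B : ℝ}
    (hbig : 16 * (B * (1 + Real.log B)) ≤ u * x)
    (hQ : ∀ q ∈ Finset.Ioc Q Q', u ≤ 2 * q ∧ 2 * (q : ℝ) ≤ B)
    {y : EuclideanSpace ℝ (Fin (m + 1))} (hy : splitFirst m y ∈ exSet J N x u A D Q Q') :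
    ∃ t ∈ Set.Ioc 0 (exRadius N x u), exWidth N x u / 2 *
      ((exCombWidth N x u / 2 * (u * x / √B)) ^ k * (exWidth N x u / 2) ^ (m - k)) ≤
        ∏ j, ‖∫ ξ in exFreq J L N x u j, cis (y j * ξ + t * ξ ^ 2)‖ := by
  obtain ⟨q, hq, a, ha0, ha, hcop, hy0, hys⟩ := exists_of_mem_exSet hxA hy
  have hq0 : 0 < q := by have := Finset.mem_Ioc.1 hq; omega
  obtain ⟨hq1, hq2⟩ := hQ q hq
  have hδ0 := exWidth_pos hN hx hu
  have hρ0 := exCombWidth_pos hN hx hu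
  have hR0 := exRadius_pos hN hx hu
  refine ⟨exTime N x u q a, ⟨exTime_pos hN hx hu hq0 ha0,
    (exTime_le hN hx hu hq0 ha).trans (by linarith)⟩, ?_⟩
  rw [Fin.prod_univ_succ, ← prod_ite_mem_fin hJ]
  have hB0 : 0 ≤ exCombWidth N x u / 2 * (u * x / √B) := by positivity
  refine mul_le_mul ?_ ?_ (Finset.prod_nonneg fun j _ => by split_ifs <;> positivity)
    (norm_nonneg _)
  · exact half_exWidth_le_first hN hx hu hq1 ha0 ha hy0
  · refine Finset.prod_le_prod (fun j _ => by split_ifs <;> positivity) fun j _ => ?_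
    have h := hys j
    rw [exFreq_succ]
    split_ifs at h ⊢
    · exact exCombWidth_le_lattice hN hx hu hq1 ha0 ha hcop hL hD hq2 hbig h
    · exact half_exWidth_le_rest hN hx hu hq1 ha0 ha h

end LargeSet

theorem exists_example {m k A : ℕ} (hk : k ≤ m) (hA : 1 ≤ A) {N x u B : ℝ}
    (hNm : N = (m : ℝ) + 1) (hxA : x = A) (huk : u = x ^ k) (hNx : 4 * Real.pi * N ≤ x)
    (hB : B = 2 * (128 * x) ^ k) (hbig : 16 * (B * (1 + Real.log B)) ≤ u * x) :
    ∃ (f : Lp ℂ 2 (volume : Measure (EuclideanSpace ℝ (Fin (m + 1)))))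
      (X : Set (EuclideanSpace ℝ (Fin (m + 1)))),
      FourierSupportedInUnitBall f ∧ MeasurableSet X ∧
      X ⊆ Metric.ball 0 (exRadius N x u) ∧
      ‖f‖ ≤ (exWidth N x u * ((u * x * exCombWidth N x u) ^ k * exWidth N x u ^ (m - k)))
        ^ (1 / 2 : ℝ) ∧
      (∀ y ∈ X, ENNReal.ofReal ((2 * Real.pi) ^ (-N / 2) * (exWidth N x u / 2 *
        ((exCombWidth N x u / 2 * (u * x / √B)) ^ k * (exWidth N x u / 2) ^ (m - k)))) ≤
          maximalFunction f (exRadius N x u) y) ∧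
      ENNReal.ofReal (4 * Real.pi * N * (u * x ^ 2) ^ 2 / (Nat.log 2 (2 * (128 * A) ^ k) + 1) *
        (((u * x ^ 2) ^ 2) ^ k * (u * x ^ 2) ^ (m - k) / 2)) ≤ volume X := by
  have hx : 1 ≤ x := by rw [hxA]; exact_mod_cast hA
  have hu : 1 ≤ u := by rw [huk]; exact one_le_pow₀ hx
  have hN : 1 ≤ N := by rw [hNm]; linarith [(Nat.cast_nonneg m : (0 : ℝ) ≤ m)]
  obtain ⟨J, -, hJ⟩ := Finset.exists_subset_card_eq (s := (Finset.univ : Finset (Fin m)))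
    (n := k) (by simpa using hk)
  have hL : ((A ^ (k + 1) : ℕ) : ℝ) = u * x := by rw [huk, hxA]; push_cast; ring
  have hD : ((128 * A : ℕ) : ℝ) = 128 * x := by rw [hxA]; push_cast; ring
  have hNn : ((m + 1 : ℕ) : ℝ) = N := by rw [hNm]; push_cast; rfl
  obtain ⟨f, hf1, hf2, hf3⟩ := exists_schrodinger_eq_prod (Nat.succ_pos m)
    (measurableSet_exFreq J (A ^ (k + 1)) N x u)
    (by rw [hNn]; exact abs_lt_of_mem_exFreq hN hx hu hL)
  -- The cutoff `(128A)^k / (2·8^k)` is the largest that discards at most half of the box; since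
  -- 128/8 = 16, the surviving denominators satisfy 2q > 16^k u.
  have hQ : ∀ q ∈ Finset.Ioc ((128 * A) ^ k / (2 * 8 ^ k)) ((128 * A) ^ k),
      u ≤ 2 * q ∧ 2 * (q : ℝ) ≤ B := by
    intro q hq
    obtain ⟨h1, h2⟩ := Finset.mem_Ioc.1 hq
    constructor
    · have h3 : (128 * A) ^ k < q * (2 * 8 ^ k) := (Nat.div_lt_iff_lt_mul (by positivity)).1 h1
      have h4 : ((128 * A : ℕ) : ℝ) ^ k < q * (2 * 8 ^ k) := by exact_mod_cast h3
      have h5 : (128 : ℝ) ^ k = 16 ^ k * 8 ^ k := by rw [← mul_pow]; norm_num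
      rw [hD, mul_pow, h5, ← huk] at h4
      have h6 : (1 : ℝ) ≤ 16 ^ k := one_le_pow₀ (by norm_num)
      have h8 : (0 : ℝ) < 8 ^ k := by positivity
      have h7 : u * 8 ^ k ≤ 16 ^ k * 8 ^ k * u := by
        have : 0 < 8 ^ k * u := by positivity
        nlinarith
      have : u * 8 ^ k < (2 * q) * 8 ^ k := by linarith
      exact (lt_of_mul_lt_mul_right this h8.le).le
    · have : (q : ℝ) ≤ ((128 * A : ℕ) : ℝ) ^ k := by exact_mod_cast h2
      rw [hB, ← hD]; linarith
  refine ⟨f, splitFirst m ⁻¹' exSet J N x u A (128 * A) ((128 * A) ^ k / (2 * 8 ^ k))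
    ((128 * A) ^ k), hf1,
    (measurePreserving_splitFirst m).measurable (measurableSet_exSet _ _ _ _ _ _ _ _), ?_, ?_, ?_,
    ?_⟩
  · exact fun y hy => mem_ball_zero_iff.2 (norm_lt_exRadius hNm hx hu hxA hy)
  · rw [hf2]
    exact Real.rpow_le_rpow (Finset.prod_nonneg fun _ _ => measureReal_nonneg)
      (prod_volume_exFreq_le hN hx hu hJ hL) (by norm_num)
  · intro y hy
    obtain ⟨t, ht, hle⟩ := le_prod_norm_integral_of_mem_exSet hJ hN hx hu hxA hL hD hbig hQ hy
    refine le_trans ?_ (le_iSup₂ (f := fun t (_ : t ∈ Set.Ioc (0 : ℝ) (exRadius N x u)) =>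
      ‖schrodinger f t y‖ₑ) t ht)
    rw [← ofReal_norm, hf3, hNn]
    apply ENNReal.ofReal_le_ofReal
    exact mul_le_mul_of_nonneg_left hle (by positivity)
  · rw [(measurePreserving_splitFirst m).measure_preimage
      (measurableSet_exSet _ _ _ _ _ _ _ _).nullMeasurableSet]
    have := le_volume_exSet (A := A) (D := 128 * A) (Q := (128 * A) ^ k / (2 * 8 ^ k)) hJ hN hx hu
      hxA hNx (by omega) (Nat.mul_div_le _ _)
    exact_mod_cast this

/-! ### Power laws -/

/-- `F` agrees on the positive half-line with a positive multiple of `x ↦ x ^ e`. -/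
def IsPowerLaw (F : ℝ → ℝ) (e : ℝ) : Prop := ∃ c > 0, ∀ x > 0, F x = c * x ^ e

namespace IsPowerLaw

variable {F G : ℝ → ℝ} {a b : ℝ}

theorem const {c : ℝ} (hc : 0 < c) : IsPowerLaw (fun _ => c) 0 :=
  ⟨c, hc, fun x _ => by simp⟩

theorem id : IsPowerLaw (fun x => x) 1 := ⟨1, one_pos, fun x _ => by simp⟩

theorem mul (hF : IsPowerLaw F a) (hG : IsPowerLaw G b) :
    IsPowerLaw (fun x => F x * G x) (a + b) := by
  obtain ⟨c, hc, h⟩ := hF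
  obtain ⟨d, hd, h'⟩ := hG
  exact ⟨c * d, mul_pos hc hd, fun x hx => by
    simp only [h x hx, h' x hx, Real.rpow_add hx]; ring⟩

theorem rpow (hF : IsPowerLaw F a) (s : ℝ) : IsPowerLaw (fun x => F x ^ s) (a * s) := by
  obtain ⟨c, hc, h⟩ := hF
  exact ⟨c ^ s, Real.rpow_pos_of_pos hc s, fun x hx => by
    simp only [h x hx]
    rw [Real.mul_rpow hc.le (Real.rpow_nonneg hx.le _), ← Real.rpow_mul hx.le]⟩

theorem pow (hF : IsPowerLaw F a) (j : ℕ) : IsPowerLaw (fun x => F x ^ j) (a * j) := by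
  simpa using hF.rpow j

theorem div (hF : IsPowerLaw F a) (hG : IsPowerLaw G b) :
    IsPowerLaw (fun x => F x / G x) (a - b) := by
  obtain ⟨c, hc, h⟩ := hF
  obtain ⟨d, hd, h'⟩ := hG
  exact ⟨c / d, div_pos hc hd, fun x hx => by
    simp only [h x hx, h' x hx, Real.rpow_sub hx, mul_div_mul_comm]⟩

theorem sqrt (hF : IsPowerLaw F a) : IsPowerLaw (fun x => √(F x)) (a * (1 / 2)) := by
  simpa [Real.sqrt_eq_rpow] using hF.rpow (1 / 2)

/-- With `u = x ^ k` the factors of the example are constants times powers of `x`, so an inequality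
along large integers becomes one between exponents and all constants drop out. -/
theorem le_of_eventually_le (hF : IsPowerLaw F a) (hG : IsPowerLaw G b)
    (h : ∀ᶠ A : ℕ in Filter.atTop, F A ≤ G A) : a ≤ b := by
  obtain ⟨c, hc, hF⟩ := hF
  obtain ⟨d, hd, hG⟩ := hG
  by_contra! hab
  have ht : Filter.Tendsto (fun A : ℕ => (A : ℝ) ^ (a - b)) Filter.atTop Filter.atTop :=
    (tendsto_rpow_atTop (sub_pos.2 hab)).comp tendsto_natCast_atTop_atTop
  obtain ⟨A, hA, hA1, hA2⟩ := (h.and ((Filter.eventually_ge_atTop 1).and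
    (ht.eventually_gt_atTop (d / c)))).exists
  have hA0 : (0 : ℝ) < A := by exact_mod_cast hA1
  rw [hF _ hA0, hG _ hA0] at hA
  rw [Real.rpow_sub hA0, div_lt_div_iff₀ hc (Real.rpow_pos_of_pos hA0 _)] at hA2
  linarith

end IsPowerLaw

theorem isPowerLaw_exRadius {N : ℝ} (hN : 0 < N) (k : ℕ) :
    IsPowerLaw (fun x => exRadius N x (x ^ k)) (2 * ((k : ℝ) + 2)) := by
  unfold exRadius
  have := (IsPowerLaw.const (c := 64 * N ^ 2) (by positivity)).mul
    (((IsPowerLaw.id.pow k).mul (IsPowerLaw.id.pow 2)).pow 2)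
  convert this using 1
  push_cast; ring

theorem isPowerLaw_exWidth {N : ℝ} (hN : 0 < N) (k : ℕ) :
    IsPowerLaw (fun x => exWidth N x (x ^ k)) (-((k : ℝ) + 2)) := by
  unfold exWidth
  have := (IsPowerLaw.const one_pos).div ((IsPowerLaw.const (c := 32 * N) (by positivity)).mul
    ((IsPowerLaw.id.pow k).mul (IsPowerLaw.id.pow 2)))
  convert this using 1
  push_cast; ring

theorem isPowerLaw_exCombWidth {N : ℝ} (hN : 0 < N) (k : ℕ) :
    IsPowerLaw (fun x => exCombWidth N x (x ^ k)) (-2 * ((k : ℝ) + 2)) := by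
  unfold exCombWidth
  have := (IsPowerLaw.const one_pos).div ((IsPowerLaw.const (c := 16) (by norm_num)).mul
    (isPowerLaw_exRadius hN k))
  convert this using 1
  ring

theorem isPowerLaw_two_mul_pow (k : ℕ) : IsPowerLaw (fun x => 2 * (128 * x) ^ k) k := by
  have := (IsPowerLaw.const (c := 2) (by norm_num)).mul
    (((IsPowerLaw.const (c := 128) (by norm_num)).mul IsPowerLaw.id).pow k)
  convert this using 1
  ring

theorem isPowerLaw_value {N : ℝ} (hN : 0 < N) (k j : ℕ) :
    IsPowerLaw (fun x => (2 * Real.pi) ^ (-N / 2) * (exWidth N x (x ^ k) / 2 *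
      ((exCombWidth N x (x ^ k) / 2 * (x ^ k * x / √(2 * (128 * x) ^ k))) ^ k *
        (exWidth N x (x ^ k) / 2) ^ j)))
      (-((k : ℝ) + 2) * (1 + j) - k * ((k : ℝ) * (3 / 2) + 3)) := by
  have h2 : IsPowerLaw (fun _ => 2) 0 := IsPowerLaw.const (by norm_num)
  have hδ := (isPowerLaw_exWidth hN k).div h2
  have hρ := (isPowerLaw_exCombWidth hN k).div h2
  have := (IsPowerLaw.const (c := (2 * Real.pi) ^ (-N / 2)) (by positivity)).mul
    (hδ.mul (((hρ.mul (((IsPowerLaw.id.pow k).mul IsPowerLaw.id).div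
      (isPowerLaw_two_mul_pow k).sqrt)).pow k).mul (hδ.pow j)))
  convert this using 1
  ring

theorem isPowerLaw_norm {N : ℝ} (hN : 0 < N) (k j : ℕ) :
    IsPowerLaw (fun x => (exWidth N x (x ^ k) * ((x ^ k * x * exCombWidth N x (x ^ k)) ^ k *
      exWidth N x (x ^ k) ^ j)) ^ (1 / 2 : ℝ))
      ((-((k : ℝ) + 2) * (1 + j) - k * ((k : ℝ) + 3)) / 2) := by
  have hδ := isPowerLaw_exWidth hN k
  have := (hδ.mul (((((IsPowerLaw.id.pow k).mul IsPowerLaw.id).mul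
    (isPowerLaw_exCombWidth hN k)).pow k).mul (hδ.pow j))).rpow (1 / 2)
  convert this using 1
  ring

theorem isPowerLaw_volume {N : ℝ} (hN : 0 < N) (k j : ℕ) :
    IsPowerLaw (fun x => 4 * Real.pi * N * (x ^ k * x ^ 2) ^ 2 *
      (((x ^ k * x ^ 2) ^ 2) ^ k * (x ^ k * x ^ 2) ^ j / 2))
      (((k : ℝ) + 2) * (2 + 2 * k + j)) := by
  have hpi := Real.pi_pos
  have hw := (IsPowerLaw.id.pow k).mul (IsPowerLaw.id.pow 2)
  have := ((IsPowerLaw.const (c := 4 * Real.pi * N) (by positivity)).mul (hw.pow 2)).mul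
    ((((hw.pow 2).pow k).mul (hw.pow j)).div (IsPowerLaw.const (c := 2) (by norm_num)))
  convert this using 1
  push_cast; ring

/-- The combs have x^(k+1) teeth and the moduli are O(x^k); the spare factor `x` absorbs the
logarithm demanded by the incomplete Gauss sum. -/
theorem eventually_log_le (k : ℕ) : ∀ᶠ A : ℕ in Filter.atTop,
    16 * (2 * (128 * (A : ℝ)) ^ k * (1 + Real.log (2 * (128 * (A : ℝ)) ^ k))) ≤
      (A : ℝ) ^ k * A := by
  set K : ℝ := 32 * 128 ^ k with hK
  have hK0 : 0 < K := by positivity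
  set c : ℝ := 1 + Real.log (2 * 128 ^ k) with hc
  have h1 : ∀ᶠ x : ℝ in Filter.atTop, ‖Real.log x‖ ≤ 1 / (2 * K * (k + 1)) * ‖x‖ :=
    Real.isLittleO_log_id_atTop.bound (by positivity)
  have h2 : ∀ᶠ x : ℝ in Filter.atTop, K * (c + k * Real.log x) ≤ x := by
    filter_upwards [h1, Filter.eventually_ge_atTop 1, Filter.eventually_ge_atTop (2 * K * c)]
      with x hx hx1 hxc
    have hx0 : 0 < x := by linarith
    have hlog := Real.log_nonneg hx1
    rw [Real.norm_of_nonneg hlog, Real.norm_of_nonneg hx0.le, div_mul_eq_mul_div, one_mul,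
      le_div_iff₀ (by positivity)] at hx
    nlinarith [mul_nonneg hK0.le hlog]
  filter_upwards [tendsto_natCast_atTop_atTop.eventually h2, Filter.eventually_ge_atTop 1]
    with A hA hA1
  have hA0 : (0 : ℝ) < A := by exact_mod_cast hA1
  have e : Real.log (2 * (128 * (A : ℝ)) ^ k) = Real.log (2 * 128 ^ k) + k * Real.log A := by
    rw [mul_pow, ← mul_assoc, Real.log_mul (by positivity) (by positivity), Real.log_pow]
  rw [e, mul_pow]
  calc _ = (A : ℝ) ^ k * (K * (c + k * Real.log A)) := by rw [hK, hc]; ring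
    _ ≤ _ := by gcongr

theorem natLog_two_add_one_le {M : ℕ} (hM : 1 ≤ M) {ε : ℝ} (hε : 0 < ε) :
    (Nat.log 2 M : ℝ) + 1 ≤ (2 / ε + 1) * (M : ℝ) ^ ε := by
  have hM' : (1 : ℝ) ≤ M := by exact_mod_cast hM
  have h1 : (Nat.log 2 M : ℝ) ≤ Real.log M / Real.log 2 := Real.natLog_le_logb M 2
  have h2 : Real.log M ≤ (M : ℝ) ^ ε / ε := Real.log_le_rpow_div (by linarith) hε
  have h3 : 1 ≤ (M : ℝ) ^ ε := Real.one_le_rpow hM' hε.le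
  have h4 : Real.log M / Real.log 2 ≤ 2 * Real.log M := by
    have := Real.log_two_gt_d9
    rw [div_le_iff₀ (by linarith)]
    have := Real.log_nonneg hM'
    nlinarith
  have h5 : (2 / ε + 1) * (M : ℝ) ^ ε = 2 * ((M : ℝ) ^ ε / ε) + (M : ℝ) ^ ε := by ring
  linarith

/-! ### The lower bound for the exponent -/

theorem mul_rpow_le_eLpNorm {α : Type*} [MeasurableSpace α] {μ : Measure α} {F : α → ℝ≥0∞}
    {X S : Set α} (hX : MeasurableSet X) (hXS : X ⊆ S) {p : ℝ} (hp : 0 < p) {V v : ℝ}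
    (hV : 0 ≤ V) (hv : 0 ≤ v) (hF : ∀ y ∈ X, ENNReal.ofReal V ≤ F y)
    (hvol : ENNReal.ofReal v ≤ μ X) :
    ENNReal.ofReal (V * v ^ (1 / p)) ≤ eLpNorm F (ENNReal.ofReal p) (μ.restrict S) := by
  have h1 : eLpNorm (X.indicator fun _ => V) (ENNReal.ofReal p) (μ.restrict S) ≤
      eLpNorm F (ENNReal.ofReal p) (μ.restrict S) := by
    refine eLpNorm_mono_enorm fun y => ?_
    by_cases hy : y ∈ X
    · rw [Set.indicator_of_mem hy, Real.enorm_of_nonneg hV]; exact hF y hy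
    · rw [Set.indicator_of_notMem hy]; simp
  refine le_trans ?_ h1
  rw [eLpNorm_indicator_const hX (by simpa using hp) ENNReal.ofReal_ne_top,
    Measure.restrict_apply hX, Set.inter_eq_left.2 hXS, Real.enorm_of_nonneg hV,
    ENNReal.toReal_ofReal hp.le, ENNReal.ofReal_mul hV,
    ← ENNReal.ofReal_rpow_of_nonneg hv (by positivity)]
  gcongr

theorem le_of_maximalEstimate {m k : ℕ} (hk : k ≤ m) {p γ : ℝ} (hp : 0 < p)
    (h : MaximalEstimate (m + 1) p γ) :
    ((m : ℝ) + k + 2) / (2 * p) - ((m : ℝ) + k + 1) / 4 + k / (4 * ((k : ℝ) + 2)) ≤ γ := by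
  set N : ℝ := (m : ℝ) + 1 with hN
  have hN0 : 0 < N := by positivity
  have hpi := Real.pi_pos
  -- Exponents of `x`: value plus 1/p times volume on the left, where kε pays for the totient
  -- logarithm; constant, R^ε, R^γ and the norm of the datum on the right.
  have key : ∀ ε : ℝ, 0 < ε →
      (-((k : ℝ) + 2) * (1 + (m - k : ℕ)) - k * ((k : ℝ) * (3 / 2) + 3)) +
        (((k : ℝ) + 2) * (2 + 2 * k + (m - k : ℕ)) - (0 + k * ε)) * (1 / p) ≤
      0 + 2 * ((k : ℝ) + 2) * ε + (2 * ((k : ℝ) + 2) * γ +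
        (-((k : ℝ) + 2) * (1 + (m - k : ℕ)) - k * ((k : ℝ) + 3)) / 2) := by
    intro ε hε
    obtain ⟨C, hC, hest⟩ := h ε hε
    have hΛ := (IsPowerLaw.const (c := 2 / ε + 1) (by positivity)).mul
      ((isPowerLaw_two_mul_pow k).rpow ε)
    refine ((isPowerLaw_value hN0 k (m - k)).mul
      (((isPowerLaw_volume hN0 k (m - k)).div hΛ).rpow (1 / p))).le_of_eventually_le
      (((IsPowerLaw.const hC).mul ((isPowerLaw_exRadius hN0 k).rpow ε)).mul
        (((isPowerLaw_exRadius hN0 k).rpow γ).mul (isPowerLaw_norm hN0 k (m - k)))) ?_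
    filter_upwards [eventually_log_le k, Filter.eventually_ge_atTop 1,
      tendsto_natCast_atTop_atTop.eventually (Filter.eventually_ge_atTop (4 * Real.pi * N))]
      with A hbig hA1 hNx
    have hx1 : (1 : ℝ) ≤ A := by exact_mod_cast hA1
    have hu1 : (1 : ℝ) ≤ (A : ℝ) ^ k := one_le_pow₀ hx1
    have hN1 : 1 ≤ N := by rw [hN]; linarith [(Nat.cast_nonneg m : (0 : ℝ) ≤ m)]
    obtain ⟨f, X, hf, hX, hXball, hfn, hfX, hXv⟩ :=
      exists_example hk hA1 hN rfl rfl hNx rfl hbig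
    have hR := le_exRadius hN1 hx1 hu1
    have hδ := exWidth_pos hN1 hx1 hu1
    have hρ := exCombWidth_pos hN1 hx1 hu1
    have h1 := mul_rpow_le_eLpNorm hX hXball hp (by positivity) (by positivity) hfX hXv
    have h2 := h1.trans (hest _ (by linarith) f hf)
    have hR0 : 0 < exRadius N A ((A : ℝ) ^ k) := by linarith
    have h3 := (ENNReal.ofReal_le_ofReal_iff (by positivity)).1 h2
    have hlog := natLog_two_add_one_le (M := 2 * (128 * A) ^ k)
      (by have : 0 < (128 * A) ^ k := by positivity
          omega) hε
    push_cast at hlog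
    refine le_trans ?_ (h3.trans ?_)
    · gcongr
      rw [div_mul_eq_mul_div]
      gcongr
    · gcongr
  have hlim : (-((k : ℝ) + 2) * (1 + (m - k : ℕ)) - k * ((k : ℝ) * (3 / 2) + 3)) +
        ((k : ℝ) + 2) * (2 + 2 * k + (m - k : ℕ)) * (1 / p) ≤ 2 * ((k : ℝ) + 2) * γ +
        (-((k : ℝ) + 2) * (1 + (m - k : ℕ)) - k * ((k : ℝ) + 3)) / 2 := by
    refine le_of_forall_pos_le_add fun ε hε => ?_
    have hK : 0 < 2 * ((k : ℝ) + 2) + k * (1 / p) := by positivity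
    -- The rescaling makes the two losses, 2(k+2) from R^ε and k/p from the logarithm, add up to
    -- exactly `ε`.
    have := key (ε / (2 * ((k : ℝ) + 2) + k * (1 / p))) (by positivity)
    have e : (2 * ((k : ℝ) + 2) + k * (1 / p)) * (ε / (2 * ((k : ℝ) + 2) + k * (1 / p))) = ε :=
      mul_div_cancel₀ _ hK.ne'
    linarith
  rw [Nat.cast_sub hk] at hlim
  have hk2 : 0 < 2 * ((k : ℝ) + 2) := by positivity
  refine le_of_mul_le_mul_left ?_ hk2
  have e : 2 * ((k : ℝ) + 2) * (((m : ℝ) + k + 2) / (2 * p) - ((m : ℝ) + k + 1) / 4 +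
      k / (4 * ((k : ℝ) + 2))) =
      ((k : ℝ) + 2) * (2 + 2 * k + ((m : ℝ) - k)) * (1 / p) -
        ((k : ℝ) + 2) * ((m : ℝ) + k + 1) / 2 + k / 2 := by
    field_simp; ring
  rw [e]
  linarith

theorem le_gammaBar {m k : ℕ} (hk : k ≤ m) {p : ℝ} (hp : 0 < p) :
    ((((m : ℝ) + k + 2) / (2 * p) - ((m : ℝ) + k + 1) / 4 + k / (4 * ((k : ℝ) + 2)) : ℝ) : EReal) ≤
      gammaBar (m + 1) p := by
  refine le_sInf ?_
  rintro _ ⟨γ, hγ, rfl⟩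
  exact EReal.coe_le_coe_iff.2 (le_of_maximalEstimate hk hp hγ)

/-! ### Comparison of the lower bounds with the critical exponents -/

theorem lt_gammaBar_of_p₀_lt {n : ℕ} (hn : 2 ≤ n) {p : ℝ} (hp : p₀ n < p) :
    (((n : ℝ) * (1 / p - (n : ℝ) / (2 * ((n : ℝ) + 1))) : ℝ) : EReal) < gammaBar n p := by
  obtain ⟨k, rfl⟩ : ∃ k, n = k + 1 + 1 := ⟨n - 2, by omega⟩
  have hk0 : (0 : ℝ) ≤ k := Nat.cast_nonneg k
  have hp0 : 0 < p := by
    refine lt_trans ?_ hp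
    unfold p₀; push_cast
    rw [show (k : ℝ) + 1 + 1 - 1 = k + 1 by ring]
    positivity
  -- One comb direction fewer than the maximum: k = n−2. The gap to the conjectured value has the
  -- sign of p(n−1)(n+2) − 2n(n+1), that is, of p − p₀(n).
  refine lt_of_lt_of_le ?_ (le_gammaBar (Nat.le_succ k) hp0)
  rw [EReal.coe_lt_coe_iff]
  have h1 : (2 * ((k : ℝ) + 2) * (k + 3)) < p * ((k + 1) * (k + 4)) := by
    unfold p₀ at hp; push_cast at hp
    have e : (2 : ℝ) + 4 / (((k : ℝ) + 1 + 1 - 1) * ((k : ℝ) + 1 + 1 + 2)) =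
        (2 * ((k : ℝ) + 2) * (k + 3)) / ((k + 1) * (k + 4)) := by
      rw [show (k : ℝ) + 1 + 1 - 1 = k + 1 by ring, show (k : ℝ) + 1 + 1 + 2 = k + 4 by ring]
      field_simp; ring
    rwa [e, div_lt_iff₀ (by positivity)] at hp
  push_cast
  rw [← sub_pos]
  have e : ((k : ℝ) + 1 + k + 2) / (2 * p) - ((k : ℝ) + 1 + k + 1) / 4 + k / (4 * ((k : ℝ) + 2)) -
      ((k : ℝ) + 1 + 1) * (1 / p - ((k : ℝ) + 1 + 1) / (2 * ((k : ℝ) + 1 + 1 + 1))) =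
      (p * ((k + 1) * (k + 4)) - 2 * ((k : ℝ) + 2) * (k + 3)) /
        (4 * p * ((k : ℝ) + 2) * (k + 3)) := by
    rw [show (k : ℝ) + 1 + 1 + 1 = k + 3 by ring]
    field_simp; ring
  rw [e]
  exact div_pos (by linarith) (by positivity)

theorem gammaBar_pos_of_lt_p₁ {n : ℕ} (hn : 1 ≤ n) {p : ℝ} (hp : 0 < p) (h : p < p₁ n hn) :
    0 < gammaBar n p := by
  obtain ⟨l, hl, hlp⟩ := (Finset.lt_sup'_iff _).1 h
  obtain ⟨hl1, hl2⟩ := Finset.mem_Icc.1 hl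
  obtain ⟨k, rfl⟩ : ∃ k, l = k + 1 := ⟨l - 1, by omega⟩
  obtain ⟨m, rfl⟩ : ∃ m, n = m + 1 := ⟨n - 1, by omega⟩
  -- A term with index `l` in the maximum corresponds to `k = l - 1` comb directions.
  refine lt_of_lt_of_le ?_ (le_gammaBar (Nat.le_of_succ_le_succ hl2) hp)
  rw [← EReal.coe_zero, EReal.coe_lt_coe_iff]
  have hk0 : (0 : ℝ) ≤ k := Nat.cast_nonneg k
  have hm0 : (0 : ℝ) ≤ m := Nat.cast_nonneg m
  push_cast at hlp
  have hd : 0 < ((m : ℝ) + k + 1) * (k + 1) + m + 1 := by positivity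
  have e1 : (2 : ℝ) + 4 / ((m : ℝ) + 1 - 1 + (k + 1) + (m + 1) / (k + 1)) =
      2 * ((m + k + 2) * (k + 2)) / (((m : ℝ) + k + 1) * (k + 1) + m + 1) := by
    rw [show (m : ℝ) + 1 - 1 + (k + 1) + (m + 1) / (k + 1) =
      (((m : ℝ) + k + 1) * (k + 1) + m + 1) / (k + 1) by field_simp; ring]
    field_simp; ring
  rw [e1, lt_div_iff₀ hd] at hlp
  have e2 : ((m : ℝ) + k + 2) / (2 * p) - ((m : ℝ) + k + 1) / 4 + k / (4 * ((k : ℝ) + 2)) =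
      (2 * ((m + k + 2) * (k + 2)) - p * (((m : ℝ) + k + 1) * (k + 1) + m + 1)) /
        (4 * p * (k + 2)) := by
    field_simp; ring
  rw [e2]
  exact div_pos (by linarith) (by positivity)

theorem p₀_lt_p₁ {n : ℕ} (hn : 1 ≤ n) (hn3 : 3 ≤ n) : p₀ n < p₁ n hn := by
  -- The index 1 term, which has no comb directions, is 2 + 4/(2n), and 2n < (n−1)(n+2) as soon as n
  -- ≥ 3.
  refine (Finset.lt_sup'_iff _).2 ⟨1, Finset.mem_Icc.2 ⟨le_rfl, hn⟩, ?_⟩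
  have h3 : (3 : ℝ) ≤ n := by exact_mod_cast hn3
  unfold p₀
  push_cast
  gcongr 2 + 4 / ?_
  · linarith
  · nlinarith

end SchrodingerMaximal

theorem corollary1p2 (n : ℕ) (hn : 1 ≤ n) (p : ℝ) (hp : 1 ≤ p) :
    (2 ≤ n →
      SchrodingerMaximal.gammaBar n p
        = (((n : ℝ) * (1 / p - (n : ℝ) / (2 * ((n : ℝ) + 1))) : ℝ) : EReal) →
      p ≤ SchrodingerMaximal.p₀ n) ∧
    (SchrodingerMaximal.gammaBar n p = 0 → SchrodingerMaximal.p₁ n hn ≤ p) ∧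
    (3 ≤ n →
      SchrodingerMaximal.p₀ n < SchrodingerMaximal.p₁ n hn ∧
      (SchrodingerMaximal.p₀ n < p → p < SchrodingerMaximal.p₁ n hn →
        SchrodingerMaximal.gammaBar n p
          ≠ ((max ((n : ℝ) * (1 / p - (n : ℝ) / (2 * ((n : ℝ) + 1)))) 0 : ℝ) : EReal))) := by
  have hp0 : 0 < p := by linarith
  refine ⟨fun hn2 h => ?_, fun h => ?_, fun hn3 => ⟨SchrodingerMaximal.p₀_lt_p₁ hn hn3,
    fun h0 h1 h => ?_⟩⟩
  · by_contra! hlt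
    exact (SchrodingerMaximal.lt_gammaBar_of_p₀_lt hn2 hlt).ne' h
  · by_contra! hlt
    exact (SchrodingerMaximal.gammaBar_pos_of_lt_p₁ hn hp0 hlt).ne' h
  · have h2 := SchrodingerMaximal.lt_gammaBar_of_p₀_lt (by omega : 2 ≤ n) h0
    have h3 := SchrodingerMaximal.gammaBar_pos_of_lt_p₁ hn hp0 h1
    rw [h] at h2 h3
    rw [← EReal.coe_zero, EReal.coe_lt_coe_iff] at h3
    rw [EReal.coe_lt_coe_iff] at h2
    exact (max_lt h2 h3).false
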